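/- **Setting.** An instance of the (unrooted) repairman problem consists of $n$ service requests located at points of a metric space, request $i$ having a time window $[w_i,e_i)$ with $1\le e_i-w_i\le 2$. A service run at speed $v$ visits locations of requests at nondecreasing times, starting anywhere at any time, such that consecutive visits $(x,t),(x',t')$ satisfy $d(x,x')\le v\,(t'-t)$; its profit is the number of requests visited during their windows. A run at speed $s$ is a $\rho$-approximation if the profit of an optimal run at unit speed is at most $\rho$ times its profit. For a period length $\alpha$ and a starting point $\sigma$, time is divided into the periods $[\sigma+c\alpha,\sigma+(c+1)\alpha)$, $c\in\mathbb Z$. No window is regarded as starting at the beginning of a period (a period beginning exactly with the window counts as only partially filled). $W_\ell$ is the set of windows that completely fill exactly $\ell$ periods. **Subroutine, $\gamma$ and $\Gamma$.** A path finder for the metric space is given which, for requests $Q$ within a period, endpoints $u,w\in Q$ and a target $1\le k\le|Q|$, finds a path from $u$ to $w$ through requests of $Q$ that visits at least $k/\gamma$ distinct requests and is no longer than any such path visiting at least $k$. The repairman algorithm for trimmed windows (each request being assigned to at most one period) calls the path finder within each period for all endpoints and targets, and pastes paths together by a dynamic program over the periods that keeps, for each last request and each profit, the earliest partial run. $\Gamma(n)$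 is any bound on the running time of this algorithm for $n$ requests, in unit-cost steps on real numbers and including the steps of the path finder. **Algorithm.** SPEEDUP, for given $\alpha$, starting point and choice of trimming, considers several sets of periods. For each, it trims the windows to the chosen one of the periods that they fill, runs the repairman algorithm at speed $s$, and retains the best run. If $s=q/r$, then with $r'=r$ for even $q+r$ and $r'=2r$ for odd $q+r$ the sets of periods are the $r'$ shifts of the starting point by multiples of $\alpha/r'$; but if the sets of periods having a boundary where some window starts or ends are no more than $r'$, or if $s$ is only given as a real number, then these are used. SPEEDUPW12 retains the best run from the following calls of SPEEDUP: * $\alpha=\frac12$, starting points $\frac i4$ with $i=0,1$, trimming windows in $W_1$, $W_2$, $W_3$ to the first, $j$-th, $k$-th period that they fill, for $j=1,2$ and $k=1,2,3$; * $\alpha=\frac34$, starting points $\frac i4$ with $i=0,1,2$, trimming windows in $W_1$, $W_2$ to the first, $j$-th period that they fill, for $j=1,2$; * $\alpha=1$, starting points $\frac i4$ with $i=0,1,2,3$, trimming windows in $W_1$ to the only period that they fill. Windows not mentioned vanish. Let $m$ be the number of distinct sets of periods of length $\frac12$, two of them being the same if every window fills the same periods in both, with the periods of a set numbered from its starting point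 in $[0,\frac12)$. **Theorem.** Let $\frac{17}7\le s\le 3$, and suppose that all windows lie in $W_3$ for some set of periods of length $\frac12$. Then SPEEDUPW12 finds a run at speed $s$ that is a $$\frac{\gamma\,(23-7s)}{1+3s-s^2}\text{-approximation},$$ in $O(\min\{r,m\}\,\Gamma(n))$ time if $s$ is given as a fraction $s=q/r$, and in $O(m\,\Gamma(n))$ time for every real $s$. The constants in the $O$-bounds are absolute. -/

import Mathlib

universe u

namespace Repairman

/-! ### Step counting -/

/-- A result together with the number of elementary steps used to obtain it.  One step is a bounded
number of operations of a real random access machine (arithmetic, comparison, rounding down, table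
access, list construction). -/
structure Timed (β : Type u) where
  val : β
  cost : ℕ

instance : Monad Timed where
  pure b := ⟨b, 0⟩
  bind x f := ⟨(f x.val).val, x.cost + (f x.val).cost⟩

/-- Charge `k` steps. -/
def tick (k : ℕ) : Timed Unit := ⟨(), k⟩

/-! ### The repairman problem -/

/-- `n` service requests at points of a metric space; request `i` is valid for service during its
time window `[opens i, closes i)`. -/
structure Instance (X : Type u) where
  n : ℕ
  loc : Fin n → X
  opens : Fin n → ℝ
  closes : Fin n → ℝ

/-- A route, as the list of the requests (with times) whose locations it visits, is a service run at
speed `v` if the times are in order and each leg can be travelled at speed `v`. -/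
def IsRun {X : Type u} [MetricSpace X] {n : ℕ} (loc : Fin n → X) (v : ℝ)
    (R : List (Fin n × ℝ)) : Prop :=
  R.IsChain fun a b => a.2 ≤ b.2 ∧ dist (loc a.1) (loc b.1) ≤ v * (b.2 - a.2)

open Classical in
/-- The number of requests that `R` visits during their time windows. -/
noncomputable def profit {X : Type u} (I : Instance X) (R : List (Fin I.n × ℝ)) : ℕ :=
  (Finset.univ.filter fun i : Fin I.n => ∃ t : ℝ, (i, t) ∈ R ∧ I.opens i ≤ t ∧ t < I.closes i).card

/-- `R` is a service run at speed `s` whose profit is, up to the factor `ρ`, at least that of every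
(hence of an optimal) service run at unit speed. -/
def IsApproximation {X : Type u} [MetricSpace X] (I : Instance X) (s ρ : ℝ)
    (R : List (Fin I.n × ℝ)) : Prop :=
  IsRun I.loc s R ∧
    ∀ Ropt : List (Fin I.n × ℝ), IsRun I.loc 1 Ropt → (profit I Ropt : ℝ) ≤ ρ * profit I R

/-! ### Periods and trimming -/

/-- The indices `c` of the periods `[σ + cα, σ + (c + 1)α)` that the window `[w, e)` fills
completely.  A period that begins exactly when the window does counts as partially filled: no window
is allowed to start at the beginning of a period, and this is what an arbitrarily small move of the
period boundaries to the left achieves. -/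
noncomputable def fullPeriods (α σ w e : ℝ) : Finset ℤ :=
  Finset.Ico (⌊(w - σ) / α⌋ + 1) ⌊(e - σ) / α⌋

theorem mem_fullPeriods {α : ℝ} (hα : 0 < α) (σ w e : ℝ) (c : ℤ) :
    c ∈ fullPeriods α σ w e ↔ w < σ + c * α ∧ σ + (c + 1) * α ≤ e := by
  unfold fullPeriods
  rw [Finset.mem_Ico, Int.add_one_le_iff, Int.floor_lt, ← Int.add_one_le_iff (a := c),
    Int.le_floor, div_lt_iff₀ hα, le_div_iff₀ hα]
  push_cast
  constructor <;> rintro ⟨h1, h2⟩ <;> constructor <;> linarith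

/-- The window `[w, e)` belongs to the set `W_ℓ` of the periods of length `α` with a boundary at `σ`:
it completely fills exactly `ℓ` of them, and apart from these only part of the period before the
first and part of the period after the last of them. -/
def InW (ℓ : ℕ) (α σ w e : ℝ) : Prop := (fullPeriods α σ w e).card = ℓ

/-- The period to which each window is trimmed: a window in `W_ℓ` is trimmed to the `j`-th period that
it fills, where `choice ℓ = some j` (counting from 1), and vanishes if `choice ℓ = none`. -/
noncomputable def trim {X : Type u} (I : Instance X) (α σ : ℝ) (choice : ℕ → Option ℕ) :
    Fin I.n → Option ℤ := fun i =>
  (choice (fullPeriods α σ (I.opens i) (I.closes i)).card).map fun j =>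
    ⌊(I.opens i - σ) / α⌋ + (j : ℤ)

/-- The number of distinct sets of periods of length `1/2`, where sets of periods are told apart by
the periods that the windows fill. -/
noncomputable def numPeriodSets {X : Type u} (I : Instance X) : ℕ :=
  ((fun (σ : ℝ) (i : Fin I.n) => fullPeriods (1 / 2) σ (I.opens i) (I.closes i)) ''
    Set.Ico 0 (1 / 2)).ncard

/-! ### Paths within a period -/

/-- The length of the path that visits the given requests in this order. -/
noncomputable def pathLength {X : Type u} [MetricSpace X] {n : ℕ} (loc : Fin n → X) :
    List (Fin n) → ℝ
  | [] => 0
  | [_] => 0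
  | a :: b :: l => dist (loc a) (loc b) + pathLength loc (b :: l)

/-- A path from `u` to `w` through requests in `Q`. -/
def IsPath {n : ℕ} (Q : Finset (Fin n)) (u w : Fin n) (p : List (Fin n)) : Prop :=
  p.head? = some u ∧ p.getLast? = some w ∧ ∀ i ∈ p, i ∈ Q

/-- A subroutine for finding profitable paths within a period: `find loc Q u w k` is a path from `u`
to `w` through requests in `Q` found for the profit target `k`, in `steps loc Q u w k` steps. -/
structure PathFinder (X : Type u) where
  find : {n : ℕ} → (Fin n → X) → Finset (Fin n) → Fin n → Fin n → ℕ → List (Fin n)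
  steps : {n : ℕ} → (Fin n → X) → Finset (Fin n) → Fin n → Fin n → ℕ → ℕ

/-- The paths found are no longer than any path that meets the profit target, and meet the target
themselves up to the factor `γ`.  (The paths found for all targets then contain, for every
bound on the length, a path within that bound whose profit is optimal up to the factor `γ`.) -/
def PathFinder.Approximates {X : Type u} [MetricSpace X] (F : PathFinder X) (γ : ℝ) : Prop :=
  ∀ (n : ℕ) (loc : Fin n → X) (Q : Finset (Fin n)) (u w : Fin n) (k : ℕ),
    u ∈ Q → w ∈ Q → 1 ≤ k → k ≤ Q.card →
      IsPath Q u w (F.find loc Q u w k) ∧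
      (k : ℝ) ≤ γ * (F.find loc Q u w k).toFinset.card ∧
      ∀ p : List (Fin n), IsPath Q u w p → k ≤ p.toFinset.card →
        pathLength loc (F.find loc Q u w k) ≤ pathLength loc p

/-! ### The repairman algorithm for trimmed windows

Each request is assigned to at most one period.  For all end points and profit targets, paths are
found within each period; a dynamic program over the periods pastes them together. -/

/-- A partial run: the time of its last visit, and its pieces (time of departure and path), the
latest piece first. -/
structure Entry (n : ℕ) where
  time : ℝ
  pieces : List (ℝ × List (Fin n))

/-- The earliest partial run found so far for each last request and each profit. -/
abbrev Table (n : ℕ) := Fin n → ℕ → Option (Entry n)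

/-- Keep the earlier one of two partial runs. -/
noncomputable def improve {n : ℕ} (o : Option (Entry n)) (e : Entry n) : Option (Entry n) :=
  match o with
  | none => some e
  | some e' => if e.time < e'.time then some e else some e'

def setEntry {n : ℕ} (T : Table n) (w : Fin n) (P : ℕ) (o : Option (Entry n)) : Table n :=
  Function.update T w (Function.update (T w) P o)

/-- The earliest way to be at request `u`, at time `a` or later, having earned profit `P` in earlier
periods. -/
noncomputable def arrival {X : Type u} [MetricSpace X] {n : ℕ} (loc : Fin n → X) (v a : ℝ)
    (T : Table n) (u : Fin n) (P : ℕ) : Timed (Option (Entry n)) := do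
  tick 1
  (List.finRange n).foldlM (fun o w => do
    tick 1
    pure (match T w P with
      | none => o
      | some e => improve o ⟨max a (e.time + dist (loc w) (loc u) / v), e.pieces⟩))
    (if P = 0 then some ⟨a, []⟩ else none)

/-- The arrivals at `u` for all profits. -/
noncomputable def arrivals {X : Type u} [MetricSpace X] {n : ℕ} (loc : Fin n → X) (v a : ℝ)
    (T : Table n) (u : Fin n) : Timed (List (ℕ × Entry n)) :=
  (List.range (n + 1)).foldlM (fun acc P => do
    tick 1
    let o ← arrival loc v a T u P
    pure (match o with
      | none => acc
      | some e => (P, e) :: acc)) []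

/-- Extend the partial runs `arr` by a path to `w` of the given length and profit, if it can be
completed before time `b`. -/
noncomputable def paste {n : ℕ} (v b : ℝ) (w : Fin n) (path : List (Fin n)) (len : ℝ)
    (gain : ℕ) (arr : List (ℕ × Entry n)) (T : Table n) : Timed (Table n) :=
  arr.foldlM (fun T x => do
    tick 1
    let t := x.2.time + len / v
    pure (if t < b then
      setEntry T w (x.1 + gain)
        (improve (T w (x.1 + gain)) ⟨t, (x.2.time, path) :: x.2.pieces⟩)
      else T)) T

/-- Process the period `[a, b)`, to which the requests in `Q` are assigned. -/
noncomputable def processPeriod {X : Type u} [MetricSpace X] (F : PathFinder X) {n : ℕ}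
    (loc : Fin n → X) (v a b : ℝ) (Q : List (Fin n)) (T₀ : Table n) : Timed (Table n) :=
  Q.foldlM (fun T u => do
    let arr ← arrivals loc v a T₀ u
    Q.foldlM (fun T w =>
      (List.range Q.length).foldlM (fun T k => do
        let path := F.find loc Q.toFinset u w (k + 1)
        tick (F.steps loc Q.toFinset u w (k + 1) + path.length + 1)
        paste v b w path (pathLength loc path) path.toFinset.card arr T) T) T) T₀

/-- The most profitable partial run in the table. -/
def selectBest {n : ℕ} (T : Table n) : Timed (ℕ × List (ℝ × List (Fin n))) :=
  (List.finRange n).foldlM (fun best w =>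
    (List.range (n + 1)).foldlM (fun best P => do
      tick 1
      pure (match T w P with
        | none => best
        | some e => if best.1 < P then (P, e.pieces) else best)) best) (0, [])

/-- The visits of a path that is left at time `t` and travelled at speed `v`. -/
noncomputable def walk {X : Type u} [MetricSpace X] {n : ℕ} (loc : Fin n → X) (v t : ℝ) :
    List (Fin n) → List (Fin n × ℝ)
  | [] => []
  | [a] => [(a, t)]
  | a :: b :: l => (a, t) :: walk loc v (t + dist (loc a) (loc b) / v) (b :: l)

/-- The repairman algorithm at speed `v` for windows trimmed to the periods
`[σ + cα, σ + (c + 1)α)`, where request `i` is assigned to the period `c` if `per i = some c`.  It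
returns a run with its profit.  The first charge is for reading the input and for sorting. -/
noncomputable def repairman {X : Type u} [MetricSpace X] (F : PathFinder X) {n : ℕ}
    (loc : Fin n → X) (v α σ : ℝ) (per : Fin n → Option ℤ) :
    Timed (ℕ × List (Fin n × ℝ)) := do
  tick ((n + 1) ^ 2)
  let periods : List ℤ := ((List.finRange n).filterMap per).dedup.insertionSort (· ≤ ·)
  let T ← periods.foldlM (fun T (c : ℤ) => do
    tick (n + 1)
    processPeriod F loc v (σ + c * α) (σ + (c + 1) * α)
      ((List.finRange n).filter fun i => per i = some c) T) (fun _ _ => none)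
  let best ← selectBest T
  let run := best.2.foldl (fun acc x => walk loc v x.1 x.2 ++ acc) []
  tick run.length
  pure (best.1, run)

/-- `Γ n` bounds the running time of the repairman algorithm on `n` requests with trimmed windows. -/
def PathFinder.RunsWithin {X : Type u} [MetricSpace X] (F : PathFinder X) (Γ : ℕ → ℕ) : Prop :=
  ∀ (n : ℕ) (loc : Fin n → X) (v α σ : ℝ) (per : Fin n → Option ℤ),
    0 < v → 0 < α → (repairman F loc v α σ per).cost ≤ Γ n

/-! ### The algorithms SPEEDUP and SPEEDUPW12 -/

/-- The speedup, given as a fraction `q / r` or as a real number. -/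
inductive Speedup where
  | frac (q r : ℕ)
  | real (s : ℝ)

noncomputable def Speedup.val : Speedup → ℝ
  | .frac q r => (q : ℝ) / r
  | .real s => s

/-- For `s = q / r`, the number of equal hops into which a period is divided: the denominator of
the representation with even `q + r`.  No such number is available for a real `s`. -/
def Speedup.hops : Speedup → Option ℕ
  | .frac q r => some (if Even (q + r) then r else 2 * r)
  | .real _ => none

/-- Keep the run of larger recorded profit. -/
def retain {n : ℕ} (best new : ℕ × List (Fin n × ℝ)) : ℕ × List (Fin n × ℝ) :=
  if best.1 < new.1 then new else best

/-- The distinct members of a list, or `none` as soon as there are more than `cap` of them. -/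
noncomputable def distinctUpTo (cap : Option ℕ) : List ℝ → List ℝ → Timed (Option (List ℝ))
  | [], acc => pure (some acc)
  | x :: xs, acc => do
    tick (acc.length + 1)
    if x ∈ acc then distinctUpTo cap xs acc
    else if cap = some acc.length then pure none
    else distinctUpTo cap xs (x :: acc)

/-- The sets of periods that SPEEDUP tries, given by the starts of their period 0: those shifted from
`base` by the multiples of a hop, or, if these are no more, those having a boundary
where some window starts or ends. -/
noncomputable def periodStarts {X : Type u} (I : Instance X) (S : Speedup) (α base : ℝ) :
    Timed (List ℝ) := do
  tick (I.n + 1)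
  let shifts ← distinctUpTo S.hops
    ((List.finRange I.n).flatMap fun i =>
      [Int.fract ((I.opens i - base) / α), Int.fract ((I.closes i - base) / α)]) []
  match shifts, S.hops with
  | some l, _ => do
    tick (l.length + 1)
    pure (l.map fun x => base + x * α)
  | none, some r => do
    tick (r + 1)
    pure ((List.range r).map fun j => base + (j : ℝ) / r * α)
  | none, none => pure []

/-- SPEEDUP: for each of the sets of periods, trim the windows and run the repairman algorithm at
speed `s`; retain the best result.  A run without visits is there to start with. -/
noncomputable def speedup {X : Type u} [MetricSpace X] (F : PathFinder X) (I : Instance X)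
    (S : Speedup) (α base : ℝ) (choice : ℕ → Option ℕ) : Timed (ℕ × List (Fin I.n × ℝ)) := do
  let starts ← periodStarts I S α base
  starts.foldlM (fun best σ => do
    tick (I.n + 1)
    let new ← repairman F I.loc S.val α σ (trim I α σ choice)
    pure (retain best new)) (0, [])

/-- Trim windows in `W_1` to their first, in `W_2` to their `j`-th, and in `W_3` to their `k`-th full
period. -/
def choice₃ (j k : ℕ) : ℕ → Option ℕ
  | 1 => some 1
  | 2 => some j
  | 3 => some k
  | _ => none

/-- Trim windows in `W_1` to their first and in `W_2` to their `j`-th full period. -/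
def choice₂ (j : ℕ) : ℕ → Option ℕ
  | 1 => some 1
  | 2 => some j
  | _ => none

/-- Trim windows in `W_1` to their first full period. -/
def choice₁ : ℕ → Option ℕ
  | 1 => some 1
  | _ => none

/-- The calls of SPEEDUP, by phases: the period length, the starting point, and the trimming. -/
noncomputable def calls : List (ℝ × ℝ × (ℕ → Option ℕ)) :=
  ((List.range 2).flatMap fun i => [1, 2].flatMap fun j => [1, 2, 3].map fun k =>
    ((1 : ℝ) / 2, (i : ℝ) / 4, choice₃ j k)) ++
  ((List.range 3).flatMap fun i => [1, 2].map fun j =>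
    ((3 : ℝ) / 4, (i : ℝ) / 4, choice₂ j)) ++
  ((List.range 4).map fun i => ((1 : ℝ), (i : ℝ) / 4, choice₁))

/-- The algorithm SPEEDUPW12 with its running time: the run it finds, together with the number of
steps. -/
noncomputable def speedupW12 {X : Type u} [MetricSpace X] (F : PathFinder X) (I : Instance X)
    (S : Speedup) : Timed (List (Fin I.n × ℝ)) := do
  let best ← calls.foldlM (fun best c => do
    let new ← speedup F I S c.1 c.2.1 c.2.2
    tick 1
    pure (retain best new)) (0, [])
  pure best.2

end Repairman

namespace Repairman

/-! ### Timed folds -/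

namespace Timed

@[simp] theorem val_bind {β δ : Type u} (x : Timed β) (f : β → Timed δ) :
    (x >>= f).val = (f x.val).val := rfl

@[simp] theorem cost_bind {β δ : Type u} (x : Timed β) (f : β → Timed δ) :
    (x >>= f).cost = x.cost + (f x.val).cost := rfl

@[simp] theorem val_pure {β : Type u} (b : β) : (pure b : Timed β).val = b := rfl

@[simp] theorem cost_pure {β : Type u} (b : β) : (pure b : Timed β).cost = 0 := rfl

@[simp] theorem cost_tick (k : ℕ) : (tick k).cost = k := rfl

theorem foldlM_induction {β : Type u} {δ : Type*} (motive : β → Prop) (l : List δ)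
    (f : β → δ → Timed β) (b : β) (hb : motive b)
    (hstep : ∀ b, motive b → ∀ a ∈ l, motive (f b a).val) : motive (l.foldlM f b).val := by
  induction l generalizing b with
  | nil => simpa using hb
  | cons a l ih =>
    rw [List.foldlM_cons, val_bind]
    exact ih _ (hstep b hb a (by simp)) fun b hb a ha => hstep b hb a (by simp [ha])

theorem foldlM_reach {β : Type u} {δ : Type*} (motive goal : β → Prop) (l : List δ)
    (f : β → δ → Timed β) (b : β) (hb : motive b)
    (hstep : ∀ b, motive b → ∀ a ∈ l, motive (f b a).val) {a : δ} (ha : a ∈ l)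
    (hreach : ∀ b, motive b → goal (f b a).val)
    (hpres : ∀ b, goal b → ∀ a ∈ l, goal (f b a).val) : goal (l.foldlM f b).val := by
  induction l generalizing b with
  | nil => simp at ha
  | cons c l ih =>
    rw [List.foldlM_cons, val_bind]
    rcases List.mem_cons.1 ha with rfl | ha
    · exact foldlM_induction goal l f _ (hreach b hb) fun b hb a ha => hpres b hb a (by simp [ha])
    · exact ih _ (hstep b hb c (by simp)) (fun b hb a ha => hstep b hb a (by simp [ha])) ha
        fun b hb a ha => hpres b hb a (by simp [ha])

theorem cost_foldlM_le {β : Type u} {δ : Type*} (l : List δ) (f : β → δ → Timed β) (b : β) (k : ℕ)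
    (h : ∀ b, ∀ a ∈ l, (f b a).cost ≤ k) : (l.foldlM f b).cost ≤ l.length * k := by
  induction l generalizing b with
  | nil => simp
  | cons a l ih =>
    rw [List.foldlM_cons, cost_bind, List.length_cons, add_mul, one_mul, add_comm]
    exact add_le_add (ih _ fun b a ha => h b a (by simp [ha])) (h b a (by simp))

end Timed

/-! ### Walks -/

section Walk

variable {X : Type u} [MetricSpace X] {n : ℕ} {loc : Fin n → X} {v : ℝ}

theorem walk_map_fst (t : ℝ) (p : List (Fin n)) : (walk loc v t p).map Prod.fst = p := by
  induction p generalizing t with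
  | nil => rfl
  | cons a l ih => cases l with
    | nil => rfl
    | cons b l => simp [walk, ih]

theorem walk_head? (t : ℝ) {p : List (Fin n)} {u : Fin n} (h : p.head? = some u) :
    (walk loc v t p).head? = some (u, t) := by
  match p, h with
  | [a], h => simpa [walk] using h
  | a :: b :: l, h => simpa [walk] using h

theorem walk_getLast? (t : ℝ) {p : List (Fin n)} {w : Fin n} (h : p.getLast? = some w) :
    (walk loc v t p).getLast? = some (w, t + pathLength loc p / v) := by
  induction p generalizing t with
  | nil => simp at h
  | cons a l ih => cases l with
    | nil => simpa [walk, pathLength] using h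
    | cons b l =>
      have := ih (t + dist (loc a) (loc b) / v) (by simpa using h)
      rw [walk, List.getLast?_cons, this]
      simp [pathLength, add_div, add_assoc]

theorem pathLength_nonneg (p : List (Fin n)) : 0 ≤ pathLength loc p := by
  induction p with
  | nil => exact le_rfl
  | cons a l ih => cases l with
    | nil => exact le_rfl
    | cons b l => exact add_nonneg dist_nonneg ih

theorem time_mem_walk (hv : 0 < v) (t : ℝ) {p : List (Fin n)} {x : Fin n × ℝ}
    (hx : x ∈ walk loc v t p) : t ≤ x.2 ∧ x.2 ≤ t + pathLength loc p / v := by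
  induction p generalizing t with
  | nil => simp [walk] at hx
  | cons a l ih => cases l with
    | nil =>
      simp only [walk, List.mem_singleton] at hx
      subst hx
      simp [pathLength]
    | cons b l =>
      have h0 : 0 ≤ dist (loc a) (loc b) / v := div_nonneg dist_nonneg hv.le
      have h1 : 0 ≤ pathLength loc (b :: l) / v := div_nonneg (pathLength_nonneg _) hv.le
      rw [pathLength, add_div]
      rw [walk, List.mem_cons] at hx
      rcases hx with rfl | hx
      · exact ⟨le_rfl, by linarith⟩
      · have := ih _ hx
        constructor <;> linarith [this.1, this.2]

theorem isRun_walk (hv : 0 < v) (t : ℝ) (p : List (Fin n)) : IsRun loc v (walk loc v t p) := by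
  induction p generalizing t with
  | nil => exact List.isChain_nil
  | cons a l ih => cases l with
    | nil => exact List.isChain_singleton _
    | cons b l =>
      have h := ih (t + dist (loc a) (loc b) / v)
      have hhd := walk_head? (loc := loc) (v := v) (t + dist (loc a) (loc b) / v)
        (p := b :: l) (u := b) rfl
      unfold IsRun at h ⊢
      rw [walk]
      obtain ⟨tl, htl⟩ : ∃ tl, walk loc v (t + dist (loc a) (loc b) / v) (b :: l) =
          (b, t + dist (loc a) (loc b) / v) :: tl := by
        cases hw : walk loc v (t + dist (loc a) (loc b) / v) (b :: l) with
        | nil => simp [hw] at hhd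
        | cons y tl => simp [hw] at hhd; exact ⟨tl, by rw [hhd]⟩
      rw [htl] at h ⊢
      refine List.isChain_cons_cons.2 ⟨⟨?_, ?_⟩, h⟩
      · have : 0 ≤ dist (loc a) (loc b) / v := div_nonneg dist_nonneg hv.le
        simpa using this
      · simp only [add_sub_cancel_left]
        rw [mul_div_cancel₀ _ hv.ne']

/-- The visits of a partial run whose pieces are given latest first. -/
noncomputable def assemble (loc : Fin n → X) (v : ℝ) (pieces : List (ℝ × List (Fin n))) :
    List (Fin n × ℝ) :=
  pieces.foldl (fun acc x => walk loc v x.1 x.2 ++ acc) []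

theorem assemble_cons (x : ℝ × List (Fin n)) (l : List (ℝ × List (Fin n))) :
    assemble loc v (x :: l) = assemble loc v l ++ walk loc v x.1 x.2 := by
  have key : ∀ (l : List (ℝ × List (Fin n))) (acc : List (Fin n × ℝ)),
      l.foldl (fun acc x => walk loc v x.1 x.2 ++ acc) acc = assemble loc v l ++ acc := by
    intro l
    induction l with
    | nil => intro acc; rfl
    | cons y l ih =>
      intro acc
      rw [List.foldl_cons, ih, show assemble loc v (y :: l) = _ from ih (walk loc v y.1 y.2 ++ [])]
      simp
  rw [assemble, List.foldl_cons, key]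
  simp

end Walk

/-! ### Tables -/

section Table

variable {n : ℕ}

theorem setEntry_apply (T : Table n) (w : Fin n) (P : ℕ) (o : Option (Entry n)) (w' : Fin n)
    (P' : ℕ) : setEntry T w P o w' P' = if w' = w ∧ P' = P then o else T w' P' := by
  unfold setEntry
  by_cases hw : w' = w
  · subst hw
    by_cases hP : P' = P
    · subst hP; simp
    · simp [hP]
  · simp [hw]

/-- The table has a partial run to `w` of profit `P` completed by time `x`. -/
def Reaches (T : Table n) (w : Fin n) (P : ℕ) (x : ℝ) : Prop :=
  ∃ e, T w P = some e ∧ e.time ≤ x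

theorem improve_cases (o : Option (Entry n)) (e : Entry n) :
    improve o e = some e ∨ ∃ e', o = some e' ∧ improve o e = some e' := by
  cases o with
  | none => exact .inl rfl
  | some e' =>
    simp only [improve]
    split_ifs
    · exact .inl rfl
    · exact .inr ⟨e', rfl, rfl⟩

theorem improve_le_new (o : Option (Entry n)) (e : Entry n) :
    ∃ r, improve o e = some r ∧ r.time ≤ e.time := by
  cases o with
  | none => exact ⟨e, rfl, le_rfl⟩
  | some e' =>
    simp only [improve]
    split_ifs with h
    · exact ⟨e, rfl, le_rfl⟩
    · exact ⟨e', rfl, not_lt.1 h⟩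

theorem improve_le_old (e' e : Entry n) :
    ∃ r, improve (some e') e = some r ∧ r.time ≤ e'.time := by
  simp only [improve]
  split_ifs with h
  · exact ⟨e, rfl, h.le⟩
  · exact ⟨e', rfl, le_rfl⟩

theorem reaches_setEntry_improve {T : Table n} {w' : Fin n} {P' : ℕ} {x : ℝ}
    (h : Reaches T w' P' x) (w : Fin n) (P : ℕ) (e : Entry n) :
    Reaches (setEntry T w P (improve (T w P) e)) w' P' x := by
  obtain ⟨e', he', hx⟩ := h
  unfold Reaches
  rw [setEntry_apply]
  split_ifs with hc
  · rw [← hc.1, ← hc.2, he']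
    obtain ⟨r, hr, hle⟩ := improve_le_old e' e
    exact ⟨r, hr, hle.trans hx⟩
  · exact ⟨e', he', hx⟩

theorem reaches_setEntry_self (T : Table n) (w : Fin n) (P : ℕ) (e : Entry n) {x : ℝ}
    (h : e.time ≤ x) : Reaches (setEntry T w P (improve (T w P) e)) w P x := by
  unfold Reaches
  rw [setEntry_apply, if_pos ⟨rfl, rfl⟩]
  obtain ⟨r, hr, hle⟩ := improve_le_new (T w P) e
  exact ⟨r, hr, hle.trans h⟩

theorem forall_setEntry_improve {valid : Fin n → ℕ → Entry n → Prop} {T : Table n}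
    (hT : ∀ w P e, T w P = some e → valid w P e) {w : Fin n} {P : ℕ} {e : Entry n}
    (he : valid w P e) (w' : Fin n) (P' : ℕ) (e' : Entry n)
    (h : setEntry T w P (improve (T w P) e) w' P' = some e') : valid w' P' e' := by
  rw [setEntry_apply] at h
  split_ifs at h with hc
  · rcases improve_cases (T w P) e with h' | ⟨e'', h', h''⟩
    · rw [h', Option.some.injEq] at h
      rw [hc.1, hc.2, ← h]; exact he
    · rw [h'', Option.some.injEq] at h
      rw [hc.1, hc.2, ← h]; exact hT _ _ _ h'
  · exact hT _ _ _ h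

theorem paste_forall {valid : Fin n → ℕ → Entry n → Prop} {v b : ℝ} {w : Fin n}
    {path : List (Fin n)} {len : ℝ} {gain : ℕ} {arr : List (ℕ × Entry n)} {T : Table n}
    (hT : ∀ w P e, T w P = some e → valid w P e)
    (harr : ∀ x ∈ arr, x.2.time + len / v < b →
      valid w (x.1 + gain) ⟨x.2.time + len / v, (x.2.time, path) :: x.2.pieces⟩) :
    ∀ w' P e, (paste v b w path len gain arr T).val w' P = some e → valid w' P e := by
  unfold paste
  refine Timed.foldlM_induction (fun T : Table n => ∀ w' P e, T w' P = some e → valid w' P e)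
    _ _ _ hT ?_
  intro T hT x hx
  simp only [Timed.val_bind, Timed.val_pure]
  split_ifs with hlt
  · exact forall_setEntry_improve hT (harr x hx hlt)
  · exact hT

theorem reaches_paste_of_reaches {v b : ℝ} {w : Fin n} {path : List (Fin n)} {len : ℝ} {gain : ℕ}
    {arr : List (ℕ × Entry n)} {T : Table n} {w' : Fin n} {P' : ℕ} {x : ℝ}
    (h : Reaches T w' P' x) : Reaches (paste v b w path len gain arr T).val w' P' x := by
  unfold paste
  refine Timed.foldlM_induction (fun T : Table n => Reaches T w' P' x) _ _ _ h ?_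
  intro T hT y hy
  simp only [Timed.val_bind, Timed.val_pure]
  split_ifs
  · exact reaches_setEntry_improve hT _ _ _
  · exact hT

theorem reaches_paste {v b : ℝ} {w : Fin n} {path : List (Fin n)} {len : ℝ} {gain : ℕ}
    {arr : List (ℕ × Entry n)} {T : Table n} {P : ℕ} {e : Entry n} {x : ℝ} (hmem : (P, e) ∈ arr)
    (hx : e.time + len / v ≤ x) (hb : x < b) :
    Reaches (paste v b w path len gain arr T).val w (P + gain) x := by
  unfold paste
  refine Timed.foldlM_reach (fun _ => True) (fun T : Table n => Reaches T w (P + gain) x) _ _ _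
    trivial (fun _ _ _ _ => trivial) hmem ?_ ?_
  · intro T _
    simp only [Timed.val_bind, Timed.val_pure]
    rw [if_pos (hx.trans_lt hb)]
    exact reaches_setEntry_self _ _ _ _ hx
  · intro T hT y hy
    simp only [Timed.val_bind, Timed.val_pure]
    split_ifs
    · exact reaches_setEntry_improve hT _ _ _
    · exact hT

variable {X : Type u} [MetricSpace X] {loc : Fin n → X} {v a : ℝ} {T : Table n} {u : Fin n} {P : ℕ}

theorem arrival_spec {e : Entry n} (h : (arrival loc v a T u P).val = some e) :
    a ≤ e.time ∧ ((P = 0 ∧ e.pieces = []) ∨ ∃ w e₀, T w P = some e₀ ∧ e.pieces = e₀.pieces ∧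
      e₀.time + dist (loc w) (loc u) / v ≤ e.time) := by
  revert e
  unfold arrival
  rw [Timed.val_bind]
  refine Timed.foldlM_induction (fun o : Option (Entry n) => ∀ {e}, o = some e →
    a ≤ e.time ∧ ((P = 0 ∧ e.pieces = []) ∨ ∃ w e₀, T w P = some e₀ ∧ e.pieces = e₀.pieces ∧
      e₀.time + dist (loc w) (loc u) / v ≤ e.time)) _ _ _ ?_ ?_
  · intro e h
    split_ifs at h with hP
    cases h
    exact ⟨le_rfl, .inl ⟨hP, rfl⟩⟩
  · intro o ho w _ e h
    simp only [Timed.val_bind, Timed.val_pure] at h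
    cases hT : T w P with
    | none => rw [hT] at h; exact ho h
    | some e₀ =>
      rw [hT] at h
      dsimp only at h
      rcases improve_cases o ⟨max a (e₀.time + dist (loc w) (loc u) / v), e₀.pieces⟩ with
        h' | ⟨e'', h', h''⟩
      · rw [h', Option.some.injEq] at h
        subst h
        exact ⟨le_max_left _ _, .inr ⟨w, e₀, hT, rfl, le_max_right _ _⟩⟩
      · rw [h'', Option.some.injEq] at h
        subst h
        exact ho h'

theorem improve_le_of_le {x : ℝ} {o : Option (Entry n)} (h : ∃ e, o = some e ∧ e.time ≤ x)
    (e : Entry n) : ∃ r, improve o e = some r ∧ r.time ≤ x := by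
  obtain ⟨e', rfl, hx⟩ := h
  obtain ⟨r, hr, hle⟩ := improve_le_old e' e
  exact ⟨r, hr, hle.trans hx⟩

theorem arrival_zero (loc : Fin n → X) (v a : ℝ) (T : Table n) (u : Fin n) :
    ∃ e, (arrival loc v a T u 0).val = some e ∧ e.time ≤ a := by
  unfold arrival
  rw [Timed.val_bind]
  refine Timed.foldlM_induction (fun o : Option (Entry n) => ∃ e, o = some e ∧ e.time ≤ a)
    _ _ _ ⟨_, rfl, le_rfl⟩ ?_
  intro o ho w _
  simp only [Timed.val_bind, Timed.val_pure]
  cases T w 0 with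
  | none => exact ho
  | some e => exact improve_le_of_le ho _

theorem arrival_le {w : Fin n} {e₀ : Entry n} (hT : T w P = some e₀) :
    ∃ e, (arrival loc v a T u P).val = some e ∧
      e.time ≤ max a (e₀.time + dist (loc w) (loc u) / v) := by
  unfold arrival
  rw [Timed.val_bind]
  refine Timed.foldlM_reach (fun _ => True) (fun o : Option (Entry n) => ∃ e, o = some e ∧
    e.time ≤ max a (e₀.time + dist (loc w) (loc u) / v)) _ _ _ trivial (fun _ _ _ _ => trivial)
    (List.mem_finRange w) ?_ ?_
  · intro o _
    simp only [Timed.val_bind, Timed.val_pure]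
    rw [hT]
    exact improve_le_new o _
  · intro o ho w' _
    simp only [Timed.val_bind, Timed.val_pure]
    cases T w' P with
    | none => exact ho
    | some e => exact improve_le_of_le ho _

theorem arrival_of_mem_arrivals {x : ℕ × Entry n} (h : x ∈ (arrivals loc v a T u).val) :
    (arrival loc v a T u x.1).val = some x.2 := by
  revert x
  unfold arrivals
  refine Timed.foldlM_induction (fun l : List (ℕ × Entry n) => ∀ {x}, x ∈ l →
    (arrival loc v a T u x.1).val = some x.2) _ _ _ (by simp) ?_
  intro acc hacc P _ x h
  simp only [Timed.val_bind, Timed.val_pure] at h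
  cases hP : (arrival loc v a T u P).val with
  | none => rw [hP] at h; exact hacc h
  | some e =>
    rw [hP] at h
    rcases List.mem_cons.1 h with rfl | h
    · exact hP
    · exact hacc h

theorem mem_arrivals {e : Entry n} (hP : P ≤ n) (h : (arrival loc v a T u P).val = some e) :
    (P, e) ∈ (arrivals loc v a T u).val := by
  unfold arrivals
  refine Timed.foldlM_reach (fun _ => True) (fun l : List (ℕ × Entry n) => (P, e) ∈ l)
    _ _ _ trivial (fun _ _ _ _ => trivial) (List.mem_range.2 (Nat.lt_succ_of_le hP)) ?_ ?_
  · intro acc _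
    simp only [Timed.val_bind, Timed.val_pure]
    rw [h]
    simp
  · intro acc hacc P' _
    simp only [Timed.val_bind, Timed.val_pure]
    cases (arrival loc v a T u P').val with
    | none => exact hacc
    | some e' => exact List.mem_cons_of_mem _ hacc

theorem selectBest_cases (T : Table n) : (selectBest T).val = (0, []) ∨
    ∃ w e, T w (selectBest T).val.1 = some e ∧ (selectBest T).val.2 = e.pieces := by
  unfold selectBest
  refine Timed.foldlM_induction (fun b : ℕ × List (ℝ × List (Fin n)) => b = (0, []) ∨
    ∃ w e, T w b.1 = some e ∧ b.2 = e.pieces) _ _ _ (.inl rfl) ?_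
  intro b hb w _
  refine Timed.foldlM_induction (fun b : ℕ × List (ℝ × List (Fin n)) => b = (0, []) ∨
    ∃ w e, T w b.1 = some e ∧ b.2 = e.pieces) _ _ _ hb ?_
  intro b hb P _
  simp only [Timed.val_bind, Timed.val_pure]
  cases hT : T w P with
  | none => exact hb
  | some e =>
    dsimp only
    split_ifs
    · exact .inr ⟨w, e, hT, rfl⟩
    · exact hb

theorem le_selectBest {w : Fin n} {e : Entry n} (hP : P ≤ n) (h : T w P = some e) :
    P ≤ (selectBest T).val.1 := by
  have hstep : ∀ (w' : Fin n) (b : ℕ × List (ℝ × List (Fin n))), P ≤ b.1 → ∀ P' ∈ List.range (n + 1),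
      P ≤ ((do
        tick 1
        pure (match T w' P' with
          | none => b
          | some e => if b.1 < P' then (P', e.pieces) else b) :
            Timed (ℕ × List (ℝ × List (Fin n))))).val.1 := by
    intro w' b hb P' _
    simp only [Timed.val_bind, Timed.val_pure]
    cases T w' P' with
    | none => exact hb
    | some e =>
      dsimp only
      split_ifs with h
      · exact hb.trans h.le
      · exact hb
  unfold selectBest
  refine Timed.foldlM_reach (fun _ => True) (fun b : ℕ × List (ℝ × List (Fin n)) => P ≤ b.1)
    _ _ _ trivial (fun _ _ _ _ => trivial) (List.mem_finRange w) ?_ ?_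
  · intro b _
    refine Timed.foldlM_reach (fun _ => True) (fun b : ℕ × List (ℝ × List (Fin n)) => P ≤ b.1)
      _ _ _ trivial (fun _ _ _ _ => trivial) (List.mem_range.2 (Nat.lt_succ_of_le hP)) ?_
      (hstep w)
    intro b _
    simp only [Timed.val_bind, Timed.val_pure]
    rw [h]
    dsimp only
    split_ifs with hlt
    · exact le_rfl
    · exact not_lt.1 hlt
  · intro b hb w' _
    exact Timed.foldlM_induction (fun b : ℕ × List (ℝ × List (Fin n)) => P ≤ b.1) _ _ _ hb
      (hstep w')

end Table

/-! ### The dynamic program -/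

section DynamicProgram

variable {X : Type u} [MetricSpace X] {n : ℕ}

/-- The entry is a service run that ends at `w`, visits requests during the processed periods to
which they are assigned, and visits at least `P` of them. -/
structure ValidEntry (loc : Fin n → X) (v α σ : ℝ) (per : Fin n → Option ℤ) (done : Finset ℤ)
    (w : Fin n) (P : ℕ) (e : Entry n) : Prop where
  isRun : IsRun loc v (assemble loc v e.pieces)
  getLast? : (assemble loc v e.pieces).getLast? = some (w, e.time)
  mem : ∀ x ∈ assemble loc v e.pieces, ∃ c ∈ done, per x.1 = some c ∧
    σ + c * α ≤ x.2 ∧ x.2 < σ + (c + 1) * α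
  le_card : P ≤ ((assemble loc v e.pieces).map Prod.fst).toFinset.card

theorem ValidEntry.mono {loc : Fin n → X} {v α σ : ℝ} {per : Fin n → Option ℤ}
    {done done' : Finset ℤ} (hd : done ⊆ done') {w : Fin n} {P : ℕ} {e : Entry n}
    (h : ValidEntry loc v α σ per done w P e) : ValidEntry loc v α σ per done' w P e where
  isRun := h.isRun
  getLast? := h.getLast?
  mem x hx := by
    obtain ⟨c, hc, h'⟩ := h.mem x hx
    exact ⟨c, hd hc, h'⟩
  le_card := h.le_card

theorem ValidEntry.le {loc : Fin n → X} {v α σ : ℝ} {per : Fin n → Option ℤ} {done : Finset ℤ}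
    {w : Fin n} {P : ℕ} {e : Entry n} (h : ValidEntry loc v α σ per done w P e) : P ≤ n :=
  h.le_card.trans ((Finset.card_le_univ _).trans (Fintype.card_fin n).le)

theorem ValidEntry.extend {loc : Fin n → X} {v α σ : ℝ} (hv : 0 < v) {per : Fin n → Option ℤ}
    {done : Finset ℤ} {c : ℤ} (hc : c ∉ done) {Q : Finset (Fin n)}
    (hQ : ∀ i ∈ Q, per i = some c) {T : Table n}
    (hT : ∀ w P e, T w P = some e → ValidEntry loc v α σ per done w P e) {u w : Fin n} {P : ℕ}
    {e : Entry n} (he : (arrival loc v (σ + c * α) T u P).val = some e) {path : List (Fin n)}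
    (hpath : IsPath Q u w path) (hlt : e.time + pathLength loc path / v < σ + (c + 1) * α) :
    ValidEntry loc v α σ per (insert c done) w (P + path.toFinset.card)
      ⟨e.time + pathLength loc path / v, (e.time, path) :: e.pieces⟩ := by
  obtain ⟨ha, hprev⟩ := arrival_spec he
  obtain ⟨hu, hw, hmem⟩ := hpath
  have hnew : ∀ x ∈ walk loc v e.time path, per x.1 = some c ∧
      σ + c * α ≤ x.2 ∧ x.2 < σ + (c + 1) * α := by
    intro x hx
    have ht := time_mem_walk hv e.time hx
    refine ⟨hQ _ (hmem _ ?_), ha.trans ht.1, ht.2.trans_lt hlt⟩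
    rw [← walk_map_fst (loc := loc) (v := v) e.time path]
    exact List.mem_map_of_mem hx
  have hold : IsRun loc v (assemble loc v e.pieces) ∧
      (∀ x ∈ assemble loc v e.pieces, ∃ c ∈ done, per x.1 = some c ∧
        σ + c * α ≤ x.2 ∧ x.2 < σ + (c + 1) * α) ∧
      P ≤ ((assemble loc v e.pieces).map Prod.fst).toFinset.card ∧
      ∀ x ∈ (assemble loc v e.pieces).getLast?,
        x.2 ≤ e.time ∧ dist (loc x.1) (loc u) ≤ v * (e.time - x.2) := by
    rcases hprev with ⟨rfl, hp⟩ | ⟨w₀, e₀, h₀, hp, ht⟩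
    · rw [hp]
      simp [assemble, IsRun]
    · rw [hp]
      have h := hT _ _ _ h₀
      refine ⟨h.isRun, h.mem, h.le_card, ?_⟩
      intro x hx
      rw [h.getLast?, Option.mem_some_iff] at hx
      subst hx
      have hd : 0 ≤ dist (loc w₀) (loc u) / v := div_nonneg dist_nonneg hv.le
      refine ⟨by dsimp only; linarith, ?_⟩
      rw [mul_comm, ← div_le_iff₀ hv]
      dsimp only
      linarith
  obtain ⟨hrun, hmem', hcard, hjoin⟩ := hold
  refine ⟨?_, ?_, ?_, ?_⟩
  · rw [assemble_cons]
    refine List.isChain_append.2 ⟨hrun, isRun_walk hv _ _, ?_⟩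
    intro x hx y hy
    rw [walk_head? _ hu, Option.mem_some_iff] at hy
    subst hy
    exact hjoin x hx
  · rw [assemble_cons, List.getLast?_append, walk_getLast? _ hw]
    rfl
  · intro x hx
    rw [assemble_cons, List.mem_append] at hx
    rcases hx with hx | hx
    · obtain ⟨c', hc', h'⟩ := hmem' x hx
      exact ⟨c', Finset.mem_insert_of_mem hc', h'⟩
    · exact ⟨c, Finset.mem_insert_self _ _, hnew x hx⟩
  · rw [assemble_cons, List.map_append, walk_map_fst, List.toFinset_append,
      Finset.card_union_of_disjoint]
    · exact Nat.add_le_add_right hcard _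
    · rw [Finset.disjoint_left]
      intro i hi hi'
      rw [List.mem_toFinset] at hi hi'
      obtain ⟨x, hx, rfl⟩ := List.mem_map.1 hi
      obtain ⟨c', hc', h', -⟩ := hmem' x hx
      rw [hQ _ (hmem _ hi'), Option.some.injEq] at h'
      exact hc (h' ▸ hc')

theorem PathFinder.Approximates.find {F : PathFinder X} {γ : ℝ} (hF : F.Approximates γ)
    (loc : Fin n → X) {Q : List (Fin n)} (hQ : Q.Nodup) {u w : Fin n} (hu : u ∈ Q) (hw : w ∈ Q)
    {k : ℕ} (hk : k < Q.length) :
    IsPath Q.toFinset u w (F.find loc Q.toFinset u w (k + 1)) ∧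
      ((k + 1 : ℕ) : ℝ) ≤ γ * (F.find loc Q.toFinset u w (k + 1)).toFinset.card ∧
      ∀ p : List (Fin n), IsPath Q.toFinset u w p → k + 1 ≤ p.toFinset.card →
        pathLength loc (F.find loc Q.toFinset u w (k + 1)) ≤ pathLength loc p :=
  hF n loc Q.toFinset u w (k + 1) (List.mem_toFinset.2 hu) (List.mem_toFinset.2 hw)
    (Nat.le_add_left _ _) (by rw [List.toFinset_card_of_nodup hQ]; exact hk)

theorem processPeriod_valid {F : PathFinder X} {γ : ℝ} (hF : F.Approximates γ) {loc : Fin n → X}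
    {v α σ : ℝ} (hv : 0 < v) {per : Fin n → Option ℤ} {done : Finset ℤ} {c : ℤ} (hc : c ∉ done)
    {Q : List (Fin n)} (hnd : Q.Nodup) (hQ : ∀ i ∈ Q, per i = some c) {T₀ : Table n}
    (hT : ∀ w P e, T₀ w P = some e → ValidEntry loc v α σ per done w P e) :
    ∀ w P e, (processPeriod F loc v (σ + c * α) (σ + (c + 1) * α) Q T₀).val w P = some e →
      ValidEntry loc v α σ per (insert c done) w P e := by
  unfold processPeriod
  refine Timed.foldlM_induction (fun T : Table n => ∀ w P e, T w P = some e →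
    ValidEntry loc v α σ per (insert c done) w P e) _ _ _
    (fun w P e h => (hT w P e h).mono (Finset.subset_insert _ _)) ?_
  intro T hT' u hu
  rw [Timed.val_bind]
  refine Timed.foldlM_induction (fun T : Table n => ∀ w P e, T w P = some e →
    ValidEntry loc v α σ per (insert c done) w P e) _ _ _ hT' ?_
  intro T hT' w hw
  refine Timed.foldlM_induction (fun T : Table n => ∀ w P e, T w P = some e →
    ValidEntry loc v α σ per (insert c done) w P e) _ _ _ hT' ?_
  intro T hT' k hk
  simp only [Timed.val_bind]
  refine paste_forall hT' fun x hx hlt => ?_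
  exact ValidEntry.extend hv hc (fun i hi => hQ i (List.mem_toFinset.1 hi)) hT
    (arrival_of_mem_arrivals hx) (hF.find loc hnd hu hw (List.mem_range.1 hk)).1 hlt

theorem reaches_processPeriod_of_reaches {F : PathFinder X} {loc : Fin n → X} {v a b : ℝ}
    {Q : List (Fin n)} {T₀ : Table n} {w : Fin n} {P : ℕ} {x : ℝ} (h : Reaches T₀ w P x) :
    Reaches (processPeriod F loc v a b Q T₀).val w P x := by
  unfold processPeriod
  refine Timed.foldlM_induction (fun T : Table n => Reaches T w P x) _ _ _ h ?_
  intro T hT u _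
  rw [Timed.val_bind]
  refine Timed.foldlM_induction (fun T : Table n => Reaches T w P x) _ _ _ hT ?_
  intro T hT w _
  refine Timed.foldlM_induction (fun T : Table n => Reaches T _ P x) _ _ _ hT ?_
  intro T hT k _
  simp only [Timed.val_bind]
  exact reaches_paste_of_reaches hT

theorem reaches_processPeriod (F : PathFinder X) {loc : Fin n → X} {v a b : ℝ} {Q : List (Fin n)}
    {T₀ : Table n} {u w : Fin n} (hu : u ∈ Q) (hw : w ∈ Q) {k : ℕ} (hk : k < Q.length) {P : ℕ}
    (hP : P ≤ n) {e : Entry n} (he : (arrival loc v a T₀ u P).val = some e) {x : ℝ}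
    (hx : e.time + pathLength loc (F.find loc Q.toFinset u w (k + 1)) / v ≤ x) (hb : x < b) :
    Reaches (processPeriod F loc v a b Q T₀).val w
      (P + (F.find loc Q.toFinset u w (k + 1)).toFinset.card) x := by
  unfold processPeriod
  have hk' : ∀ w' u' : Fin n, ∀ T : Table n, ∀ P' : ℕ, Reaches T w P' x → ∀ l : List ℕ,
      Reaches (l.foldlM (fun T k => do
        let path := F.find loc Q.toFinset u' w' (k + 1)
        tick (F.steps loc Q.toFinset u' w' (k + 1) + path.length + 1)
        paste v b w' path (pathLength loc path) path.toFinset.card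
          (arrivals loc v a T₀ u').val T) T : Timed (Table n)).val w P' x := by
    intro w' u' T P' hT l
    refine Timed.foldlM_induction (fun T : Table n => Reaches T w P' x) _ _ _ hT ?_
    intro T hT k _
    simp only [Timed.val_bind]
    exact reaches_paste_of_reaches hT
  refine Timed.foldlM_reach (fun _ => True) (fun T : Table n => Reaches T w
      (P + (F.find loc Q.toFinset u w (k + 1)).toFinset.card) x)
    _ _ _ trivial (fun _ _ _ _ => trivial) hu ?_ ?_
  · intro T _
    rw [Timed.val_bind]
    refine Timed.foldlM_reach (fun _ => True) (fun T : Table n => Reaches T w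
      (P + (F.find loc Q.toFinset u w (k + 1)).toFinset.card) x)
      _ _ _ trivial (fun _ _ _ _ => trivial) hw ?_ fun T hT w' _ => hk' w' u T _ hT _
    intro T _
    refine Timed.foldlM_reach (fun _ => True) (fun T : Table n => Reaches T w
      (P + (F.find loc Q.toFinset u w (k + 1)).toFinset.card) x)
      _ _ _ trivial (fun _ _ _ _ => trivial) (List.mem_range.2 hk) ?_ ?_
    · intro T _
      simp only [Timed.val_bind]
      exact reaches_paste (mem_arrivals hP he) hx hb
    · intro T hT k' _
      simp only [Timed.val_bind]
      exact reaches_paste_of_reaches hT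
  · intro T hT u' _
    rw [Timed.val_bind]
    exact Timed.foldlM_induction (fun T : Table n => Reaches T w
      (P + (F.find loc Q.toFinset u w (k + 1)).toFinset.card) x) _ _ _ hT
      fun T hT w' _ => hk' w' u' T _ hT _

/-- The requests in `H` can all be serviced at speed `v` within their periods, `i` at time `τ i`. -/
structure Serviceable (loc : Fin n → X) (v α σ : ℝ) (per : Fin n → Option ℤ) (H : Finset (Fin n))
    (τ : Fin n → ℝ) : Prop where
  mem : ∀ i ∈ H, ∃ c : ℤ, per i = some c ∧ σ + c * α ≤ τ i ∧ τ i < σ + (c + 1) * α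
  dist_le : ∀ i ∈ H, ∀ j ∈ H, dist (loc i) (loc j) ≤ v * |τ i - τ j|

theorem exists_isPath_of_finset {loc : Fin n → X} {v : ℝ} {τ : Fin n → ℝ} (H : Finset (Fin n))
    (hne : H.Nonempty) (hd : ∀ i ∈ H, ∀ j ∈ H, dist (loc i) (loc j) ≤ v * |τ i - τ j|) :
    ∃ u ∈ H, ∃ w ∈ H, (∀ j ∈ H, τ u ≤ τ j ∧ τ j ≤ τ w) ∧ ∃ p : List (Fin n), IsPath H u w p ∧
      p.toFinset = H ∧ pathLength loc p ≤ v * (τ w - τ u) := by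
  induction H using Finset.strongInduction with
  | H H ih =>
    obtain ⟨w, hw, hmax⟩ := H.exists_max_image τ hne
    rcases (H.erase w).eq_empty_or_nonempty with h0 | h0
    · have hH : H = {w} := by
        rw [← Finset.insert_erase hw, h0, insert_empty_eq]
      refine ⟨w, hw, w, hw, ?_, [w], ⟨rfl, rfl, by simpa using hw⟩, by simp [hH],
        by simp [pathLength]⟩
      intro j hj
      rw [hH, Finset.mem_singleton] at hj
      subst hj
      exact ⟨le_rfl, le_rfl⟩
    · obtain ⟨u, hu, w', hw', hb, p, ⟨hp1, hp2, hp3⟩, hpf, hlen⟩ :=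
        ih (H.erase w) (Finset.erase_ssubset hw) h0
          fun i hi j hj => hd i (Finset.mem_of_mem_erase hi) j (Finset.mem_of_mem_erase hj)
      have hpl : ∀ (p : List (Fin n)), p.getLast? = some w' →
          pathLength loc (p ++ [w]) = pathLength loc p + dist (loc w') (loc w) := by
        intro p
        induction p with
        | nil => simp
        | cons a l ih => cases l with
          | nil =>
            intro h
            simp only [List.getLast?_singleton, Option.some.injEq] at h
            simp [pathLength, h]
          | cons b l =>
            intro h
            have := ih (by simpa using h)
            simp only [List.cons_append, pathLength] at this ⊢
            rw [this, add_assoc]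
      have huH := Finset.mem_of_mem_erase hu
      have hw'H := Finset.mem_of_mem_erase hw'
      refine ⟨u, huH, w, hw, ?_, p ++ [w], ⟨?_, by simp, ?_⟩, ?_, ?_⟩
      · intro j hj
        refine ⟨?_, hmax j hj⟩
        by_cases hjw : j = w
        · rw [hjw]; exact hmax u huH
        · exact (hb j (Finset.mem_erase.2 ⟨hjw, hj⟩)).1
      · rw [List.head?_append, hp1]; rfl
      · intro i hi
        rcases List.mem_append.1 hi with hi | hi
        · exact Finset.mem_of_mem_erase (hp3 i hi)
        · rw [List.mem_singleton.1 hi]; exact hw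
      · rw [List.toFinset_append, hpf]
        ext i
        by_cases hi : i = w <;> simp [hi, hw]
      · rw [hpl p hp2]
        have h1 := hd w' hw'H w hw
        rw [abs_sub_comm, abs_of_nonneg (sub_nonneg.2 (hmax w' hw'H))] at h1
        linarith

/-- Up to the factor `γ`, the partial runs in `T` do as well as servicing the requests of `H` that
are assigned to the processed periods. -/
def Covers (γ : ℝ) (per : Fin n → Option ℤ) (H : Finset (Fin n)) (τ : Fin n → ℝ)
    (done : Finset ℤ) (T : Table n) : Prop :=
  (∀ i ∈ H, ∀ c ∈ done, per i ≠ some c) ∨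
    ∃ w ∈ H, ∃ c ∈ done, per w = some c ∧ ∃ P : ℕ, Reaches T w P (τ w) ∧
      ((H.filter fun i => ∃ c ∈ done, per i = some c).card : ℝ) ≤ γ * P

theorem Covers.processPeriod {F : PathFinder X} {γ : ℝ} (hF : F.Approximates γ)
    {loc : Fin n → X} {v α σ : ℝ} (hv : 0 < v) (hα : 0 < α) {per : Fin n → Option ℤ}
    {H : Finset (Fin n)} {τ : Fin n → ℝ} (hH : Serviceable loc v α σ per H τ) {done : Finset ℤ}
    {c : ℤ} (hc : ∀ c' ∈ done, c' < c) {T₀ : Table n}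
    (hT : ∀ w P e, T₀ w P = some e → ValidEntry loc v α σ per done w P e)
    (hcov : Covers γ per H τ done T₀) :
    Covers γ per H τ (insert c done) (Repairman.processPeriod F loc v (σ + c * α) (σ + (c + 1) * α)
      ((List.finRange n).filter fun i => per i = some c) T₀).val := by
  set Q := (List.finRange n).filter fun i => per i = some c with hQdef
  have hQ : ∀ i, i ∈ Q ↔ per i = some c := fun i => by simp [hQdef]
  have hnd : Q.Nodup := (List.nodup_finRange n).filter _
  set G := H.filter fun i => per i = some c with hG
  have hGH : G ⊆ H := Finset.filter_subset _ _
  have hsplit : (H.filter fun i => ∃ c' ∈ insert c done, per i = some c') =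
      (H.filter fun i => ∃ c' ∈ done, per i = some c') ∪ G := by
    ext i
    simp only [hG, Finset.mem_filter, Finset.mem_union, Finset.mem_insert]
    constructor
    · rintro ⟨hi, c', rfl | hc', h⟩
      · exact .inr ⟨hi, h⟩
      · exact .inl ⟨hi, c', hc', h⟩
    · rintro (⟨hi, c', hc', h⟩ | ⟨hi, h⟩)
      · exact ⟨hi, c', .inr hc', h⟩
      · exact ⟨hi, c, .inl rfl, h⟩
  rcases G.eq_empty_or_nonempty with h0 | h0
  · have hno : ∀ i ∈ H, per i ≠ some c := fun i hi h =>
      Finset.notMem_empty i (h0 ▸ Finset.mem_filter.2 ⟨hi, h⟩)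
    rcases hcov with h | ⟨w, hw, c', hc', hwc, P, hP, hle⟩
    · left
      intro i hi c' hc'
      rcases Finset.mem_insert.1 hc' with rfl | hc'
      · exact hno i hi
      · exact h i hi c' hc'
    · right
      refine ⟨w, hw, c', Finset.mem_insert_of_mem hc', hwc, P,
        reaches_processPeriod_of_reaches hP, ?_⟩
      rw [hsplit, h0, Finset.union_empty]
      exact hle
  · right
    obtain ⟨u, hu, w, hw, -, p, hp, hpG, hlen⟩ := exists_isPath_of_finset (τ := τ) G h0
      fun i hi j hj => hH.dist_le i (hGH hi) j (hGH hj)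
    have huc := (Finset.mem_filter.1 hu).2
    have hwc := (Finset.mem_filter.1 hw).2
    have hGQ : G ⊆ Q.toFinset := fun i hi => by
      rw [List.mem_toFinset, hQ]; exact (Finset.mem_filter.1 hi).2
    obtain ⟨k, hk⟩ : ∃ k, G.card = k + 1 := ⟨G.card - 1, by have := h0.card_pos; omega⟩
    have hkQ : k < Q.length := by
      have := Finset.card_le_card hGQ
      rw [List.toFinset_card_of_nodup hnd] at this
      omega
    obtain ⟨-, hgain, hshort⟩ := hF.find loc hnd ((hQ u).2 huc) ((hQ w).2 hwc) hkQ
    have hlen' : pathLength loc (F.find loc Q.toFinset u w (k + 1)) / v ≤ τ w - τ u := by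
      rw [div_le_iff₀ hv, mul_comm]
      exact (hshort p ⟨hp.1, hp.2.1, fun i hi => hGQ (hp.2.2 i hi)⟩
        (by rw [hpG, hk])).trans hlen
    obtain ⟨c₁, h₁, hu1, hu2⟩ := hH.mem u (hGH hu)
    obtain rfl : c₁ = c := by rw [huc] at h₁; exact (Option.some.inj h₁).symm
    obtain ⟨c₂, h₂, hw1, hw2⟩ := hH.mem w (hGH hw)
    obtain rfl : c₂ = c₁ := by rw [hwc] at h₂; exact (Option.some.inj h₂).symm
    obtain ⟨P, e, hP, he, het, hPle⟩ : ∃ (P : ℕ) (e : Entry n), P ≤ n ∧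
        (arrival loc v (σ + c₂ * α) T₀ u P).val = some e ∧ e.time ≤ τ u ∧
        ((H.filter fun i => ∃ c' ∈ done, per i = some c').card : ℝ) ≤ γ * P := by
      rcases hcov with h | ⟨w₀, hw₀, c', hc', hwc', P, ⟨e₀, he₀, ht₀⟩, hle⟩
      · obtain ⟨e, he, het⟩ := arrival_zero loc v (σ + c₂ * α) T₀ u
        refine ⟨0, e, Nat.zero_le _, he, het.trans hu1, ?_⟩
        rw [Finset.filter_false_of_mem]
        · simp
        · rintro i hi ⟨c', hc', h'⟩
          exact h i hi c' hc' h'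
      · obtain ⟨e, he, het⟩ := arrival_le (loc := loc) (v := v) (a := σ + c₂ * α) (u := u) he₀
        refine ⟨P, e, (hT _ _ _ he₀).le, he, het.trans (max_le hu1 ?_), hle⟩
        have hd := hH.dist_le w₀ hw₀ u (hGH hu)
        obtain ⟨c₃, h₃, h31, h32⟩ := hH.mem w₀ hw₀
        obtain rfl : c₃ = c' := by rw [hwc'] at h₃; exact (Option.some.inj h₃).symm
        have hcc : ((c₃ : ℝ) + 1) * α ≤ c₂ * α := by
          have : c₃ + 1 ≤ c₂ := hc _ hc'
          have : ((c₃ : ℝ) + 1) ≤ c₂ := by exact_mod_cast this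
          gcongr
        rw [abs_sub_comm, abs_of_nonneg (by linarith), mul_comm, ← div_le_iff₀ hv] at hd
        linarith
    refine ⟨w, hGH hw, c₂, Finset.mem_insert_self _ _, hwc, _,
      reaches_processPeriod F ((hQ u).2 huc) ((hQ w).2 hwc) hkQ hP he (x := τ w) (by linarith)
        hw2, ?_⟩
    rw [hsplit]
    have hun : ((((H.filter fun i => ∃ c' ∈ done, per i = some c') ∪ G).card : ℕ) : ℝ) ≤
        (H.filter fun i => ∃ c' ∈ done, per i = some c').card + ((k + 1 : ℕ) : ℝ) := by
      rw [← hk]; exact_mod_cast Finset.card_union_le _ _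
    push_cast at hun hgain ⊢
    linarith

variable {F : PathFinder X} {γ : ℝ}

theorem periods_fold (hF : F.Approximates γ) {loc : Fin n → X} {v α σ : ℝ} (hv : 0 < v)
    (hα : 0 < α) {per : Fin n → Option ℤ} (l : List ℤ) (hl : l.Pairwise (· < ·)) (done : Finset ℤ)
    (hdone : ∀ c' ∈ done, ∀ c ∈ l, c' < c) (T : Table n)
    (hT : ∀ w P e, T w P = some e → ValidEntry loc v α σ per done w P e) :
    let T' := (l.foldlM (fun T (c : ℤ) => do
      tick (n + 1)
      processPeriod F loc v (σ + c * α) (σ + (c + 1) * α)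
        ((List.finRange n).filter fun i => per i = some c) T) T : Timed (Table n)).val
    (∀ w P e, T' w P = some e → ValidEntry loc v α σ per (done ∪ l.toFinset) w P e) ∧
      ∀ H τ, Serviceable loc v α σ per H τ → Covers γ per H τ done T →
        Covers γ per H τ (done ∪ l.toFinset) T' := by
  induction l generalizing done T with
  | nil => simpa using hT
  | cons c l ih =>
    rw [List.pairwise_cons] at hl
    have hc : ∀ c' ∈ done, c' < c := fun c' hc' => hdone c' hc' c (by simp)
    have hvalid := processPeriod_valid hF hv (fun h => (hc c h).false)
      ((List.nodup_finRange n).filter fun i => per i = some c)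
      (fun i hi => by simpa using hi) hT
    have := ih hl.2 (insert c done) (by
      intro c' hc' d hd
      rcases Finset.mem_insert.1 hc' with rfl | hc'
      · exact hl.1 d hd
      · exact hdone c' hc' d (by simp [hd])) _ hvalid
    have hset : done ∪ (c :: l).toFinset = insert c done ∪ l.toFinset := by
      ext; simp
    rw [hset]
    exact ⟨this.1, fun H τ hH hcov => this.2 H τ hH (hcov.processPeriod hF hv hα hH hc hT)⟩

theorem repairman_val (loc : Fin n → X) (v α σ : ℝ) (per : Fin n → Option ℤ) :
    ∃ T : Table n, (repairman F loc v α σ per).val.1 = (selectBest T).val.1 ∧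
      (repairman F loc v α σ per).val.2 = assemble loc v (selectBest T).val.2 ∧
      T = ((((List.finRange n).filterMap per).dedup.insertionSort (· ≤ ·)).foldlM
        (fun T (c : ℤ) => do
          tick (n + 1)
          processPeriod F loc v (σ + c * α) (σ + (c + 1) * α)
            ((List.finRange n).filter fun i => per i = some c) T)
        (fun _ _ => none) : Timed (Table n)).val :=
  ⟨_, rfl, rfl, rfl⟩

/-- The repairman algorithm returns a run that visits requests during their periods only, at least as
many as recorded. -/
theorem repairman_sound (hF : F.Approximates γ) (loc : Fin n → X) {v α : ℝ} (σ : ℝ) (hv : 0 < v)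
    (hα : 0 < α) (per : Fin n → Option ℤ) :
    IsRun loc v (repairman F loc v α σ per).val.2 ∧
      (∀ x ∈ (repairman F loc v α σ per).val.2, ∃ c : ℤ, per x.1 = some c ∧
        σ + c * α ≤ x.2 ∧ x.2 < σ + (c + 1) * α) ∧
      (repairman F loc v α σ per).val.1 ≤
        ((repairman F loc v α σ per).val.2.map Prod.fst).toFinset.card := by
  obtain ⟨T, h1, h2, hT⟩ := repairman_val (F := F) loc v α σ per
  rw [h1, h2]
  have hsort : (((List.finRange n).filterMap per).dedup.insertionSort (· ≤ ·)).Pairwise (· < ·) :=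
    (List.sortedLE_insertionSort.sortedLT_of_nodup
      ((List.perm_insertionSort _ _).nodup_iff.2 (List.nodup_dedup _))).pairwise
  have key := (periods_fold hF hv hα (per := per) (σ := σ) (loc := loc) _ hsort ∅ (by simp)
    (fun _ _ => none) (by simp)).1
  rw [← hT] at key
  rcases selectBest_cases T with h | ⟨w, e, he, hp⟩
  · rw [h]
    simp [assemble, IsRun]
  · rw [hp]
    have := key _ _ _ he
    refine ⟨this.isRun, fun x hx => ?_, this.le_card⟩
    obtain ⟨c, -, hc⟩ := this.mem x hx
    exact ⟨c, hc⟩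

/-- The profit recorded by the repairman algorithm is optimal up to the factor `γ`. -/
theorem repairman_complete (hF : F.Approximates γ) (hγ : 0 ≤ γ) {loc : Fin n → X} {v α σ : ℝ}
    (hv : 0 < v) (hα : 0 < α) {per : Fin n → Option ℤ} {H : Finset (Fin n)} {τ : Fin n → ℝ}
    (hH : Serviceable loc v α σ per H τ) :
    (H.card : ℝ) ≤ γ * (repairman F loc v α σ per).val.1 := by
  obtain ⟨T, h1, -, hT⟩ := repairman_val (F := F) loc v α σ per
  rw [h1]
  set l := ((List.finRange n).filterMap per).dedup.insertionSort (· ≤ ·) with hl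
  have hmem : ∀ i c, per i = some c → c ∈ ∅ ∪ l.toFinset := by
    intro i c hi
    rw [Finset.empty_union, List.mem_toFinset, hl, List.mem_insertionSort, List.mem_dedup,
      List.mem_filterMap]
    exact ⟨i, List.mem_finRange i, hi⟩
  have hsort : l.Pairwise (· < ·) :=
    (List.sortedLE_insertionSort.sortedLT_of_nodup
      ((List.perm_insertionSort _ _).nodup_iff.2 (List.nodup_dedup _))).pairwise
  have key := periods_fold hF hv hα (per := per) (σ := σ) (loc := loc) _ hsort ∅ (by simp)
    (fun _ _ => none) (by simp)
  rw [← hT] at key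
  rcases key.2 H τ hH (.inl (by simp)) with h | ⟨w, hw, c, hc, hwc, P, ⟨e, he, -⟩, hle⟩
  · have : H = ∅ := by
      rw [Finset.eq_empty_iff_forall_notMem]
      intro i hi
      obtain ⟨c, hc, -⟩ := hH.mem i hi
      exact h i hi c (hmem i c hc) hc
    rw [this]
    simp only [Finset.card_empty, Nat.cast_zero]
    positivity
  · rw [Finset.filter_true_of_mem] at hle
    · refine hle.trans ?_
      have : P ≤ (selectBest T).val.1 := le_selectBest (key.1 _ _ _ he).le he
      gcongr
    · intro i hi
      obtain ⟨c, hc, -⟩ := hH.mem i hi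
      exact ⟨c, hmem i c hc, hc⟩

end DynamicProgram

/-! ### Racing back and forth along a unit-speed run -/

/-- At speed `s₀`, a run can service within each period all requests that a unit-speed run visits
during an interval of length `α (s₀ + 1) / 2`, the intervals for the periods being shifts of each
other like the periods themselves. -/
theorem serviceable_of_racing {X : Type u} [MetricSpace X] {n : ℕ} {loc : Fin n → X}
    {s₀ v α : ℝ} (σ x : ℝ) (hs : 1 ≤ s₀) (hv : s₀ ≤ v) (hα : 0 < α) {per : Fin n → Option ℤ}
    {H : Finset (Fin n)} (c : Fin n → ℤ) (t : Fin n → ℝ) (hper : ∀ i ∈ H, per i = some (c i))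
    (hdist : ∀ i ∈ H, ∀ j ∈ H, dist (loc i) (loc j) ≤ |t i - t j|)
    (hmem : ∀ i ∈ H, σ + c i * α + x ≤ t i ∧ t i < σ + c i * α + x + α * (s₀ + 1) / 2) :
    Serviceable loc v α σ per H fun i =>
      σ + c i * α + (α * (s₀ - 1) / 2 + (t i - (σ + c i * α + x))) / s₀ := by
  have hs0 : 0 < s₀ := by linarith
  refine ⟨fun i hi => ⟨c i, hper i hi, ?_, ?_⟩, ?_⟩
  · have h1 := (hmem i hi).1
    have : 0 ≤ (α * (s₀ - 1) / 2 + (t i - (σ + c i * α + x))) / s₀ := by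
      have : 0 ≤ α * (s₀ - 1) := mul_nonneg hα.le (by linarith)
      apply div_nonneg _ hs0.le
      linarith
    linarith
  · have h2 := (hmem i hi).2
    have : (α * (s₀ - 1) / 2 + (t i - (σ + c i * α + x))) / s₀ < α := by
      rw [div_lt_iff₀ hs0]
      linarith
    linarith
  · have key : ∀ i ∈ H, ∀ j ∈ H, c j ≤ c i → |t i - t j| ≤ s₀ *
        |σ + c i * α + (α * (s₀ - 1) / 2 + (t i - (σ + c i * α + x))) / s₀ -
          (σ + c j * α + (α * (s₀ - 1) / 2 + (t j - (σ + c j * α + x))) / s₀)| := by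
      intro i hi j hj hij
      have e1 : s₀ * |σ + c i * α + (α * (s₀ - 1) / 2 + (t i - (σ + c i * α + x))) / s₀ -
          (σ + c j * α + (α * (s₀ - 1) / 2 + (t j - (σ + c j * α + x))) / s₀)| =
          |((c i : ℝ) - c j) * α * (s₀ - 1) + (t i - t j)| := by
        rw [← abs_of_pos hs0, ← abs_mul, abs_of_pos hs0]
        congr 1
        field_simp
        ring
      rw [e1]
      rcases hij.eq_or_lt with h | h
      · rw [h]; simp
      · have hk : (1 : ℝ) ≤ (c i : ℝ) - c j := by
          have : c j + 1 ≤ c i := h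
          have : ((c j : ℝ) + 1) ≤ c i := by exact_mod_cast this
          linarith
        have h1 := (hmem i hi).1
        have h2 := (hmem j hj).2
        have h3 : 0 ≤ ((c i : ℝ) - c j) * α * (s₀ - 1) :=
          mul_nonneg (mul_nonneg (by linarith) hα.le) (by linarith)
        have h4 : α * (s₀ + 1) ≤ ((c i : ℝ) - c j) * (α * (s₀ + 1)) :=
          le_mul_of_one_le_left (mul_nonneg hα.le (by linarith)) hk
        refine abs_le.2 ⟨?_, ?_⟩
        · have := le_abs_self (((c i : ℝ) - c j) * α * (s₀ - 1) + (t i - t j))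
          nlinarith
        · have := le_abs_self (((c i : ℝ) - c j) * α * (s₀ - 1) + (t i - t j))
          linarith
    intro i hi j hj
    refine (hdist i hi j hj).trans (le_trans ?_ (mul_le_mul_of_nonneg_right hv (abs_nonneg _)))
    rcases le_total (c j) (c i) with h | h
    · exact key i hi j hj h
    · have := key j hj i hi h
      rwa [abs_sub_comm, abs_sub_comm (_ + _) (_ + _)] at this

/-! ### Counting period boundaries -/

theorem one_le_floor_sub_floor {α σ A B : ℝ} (hα : 0 < α) {k : ℤ} (hA : A < σ + k * α)
    (hB : σ + k * α ≤ B) : 1 ≤ ⌊(B - σ) / α⌋ - ⌊(A - σ) / α⌋ := by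
  have h1 : k ≤ ⌊(B - σ) / α⌋ := by
    rw [Int.le_floor, le_div_iff₀ hα]; linarith
  have h2 : ⌊(A - σ) / α⌋ < k := by
    rw [Int.floor_lt, div_lt_iff₀ hα]; linarith
  omega

theorem floor_sub_floor_nonneg {α σ A B : ℝ} (hα : 0 < α) (h : A ≤ B) :
    0 ≤ ⌊(B - σ) / α⌋ - ⌊(A - σ) / α⌋ :=
  sub_nonneg.2 (Int.floor_le_floor (by gcongr))

/-- The first period boundary after `w`. -/
noncomputable def nextBoundary (α σ w : ℝ) : ℝ := σ + (⌊(w - σ) / α⌋ + 1 : ℤ) * α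

/-- The last period boundary up to `e`. -/
noncomputable def lastBoundary (α σ e : ℝ) : ℝ := σ + (⌊(e - σ) / α⌋ : ℤ) * α

theorem lastBoundary_le {α : ℝ} (hα : 0 < α) (σ e : ℝ) : lastBoundary α σ e ≤ e := by
  have := Int.floor_le ((e - σ) / α)
  rw [le_div_iff₀ hα] at this
  unfold lastBoundary
  linarith

theorem lt_lastBoundary {α : ℝ} (hα : 0 < α) (σ e : ℝ) : e - α < lastBoundary α σ e := by
  have := Int.lt_floor_add_one ((e - σ) / α)
  rw [div_lt_iff₀ hα] at this
  unfold lastBoundary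
  linarith

theorem nextBoundary_eq (α σ w : ℝ) : nextBoundary α σ w = lastBoundary α σ w + α := by
  unfold nextBoundary lastBoundary
  push_cast
  ring

/-- The run that starts early, trimming to the first period, services a request visited at `t`. -/
def EarlyHit (α κ θ σ w t : ℝ) : Prop :=
  nextBoundary α σ w - α + θ ≤ t ∧ t < nextBoundary α σ w + κ + θ

/-- The run that ends late, trimming to the last period, services a request visited at `t`. -/
def LateHit (α κ θ σ e t : ℝ) : Prop :=
  lastBoundary α σ e - κ - θ ≤ t ∧ t < lastBoundary α σ e + α - θ

open Classical in
theorem earlyMiss_le {α : ℝ} (hα : 0 < α) (κ θ σ w t : ℝ) :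
    (if EarlyHit α κ θ σ w t then 0 else 1 : ℤ) ≤
      (⌊(max w (t - κ - θ) - σ) / α⌋ - ⌊(w - σ) / α⌋) +
        (⌊(w + α - σ) / α⌋ - ⌊(min (w + α) (t + α - θ) - σ) / α⌋) := by
  have h1 := floor_sub_floor_nonneg (σ := σ) hα (le_max_left w (t - κ - θ))
  have h2 := floor_sub_floor_nonneg (σ := σ) hα (min_le_left (w + α) (t + α - θ))
  have hg1 := lt_lastBoundary hα σ w
  have hg2 := lastBoundary_le hα σ w
  have hg := nextBoundary_eq α σ w
  split_ifs with h
  · linarith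
  · rw [EarlyHit, not_and_or, not_le, not_lt] at h
    rcases h with h | h
    · have := one_le_floor_sub_floor (σ := σ) (k := ⌊(w - σ) / α⌋ + 1) (B := w + α)
        (A := min (w + α) (t + α - θ)) hα
        (lt_of_le_of_lt (min_le_right _ _) (by change _ < nextBoundary α σ w; linarith))
        (by change nextBoundary α σ w ≤ _; linarith)
      linarith
    · have := one_le_floor_sub_floor (σ := σ) (k := ⌊(w - σ) / α⌋ + 1) (A := w)
        (B := max w (t - κ - θ)) hα (by change _ < nextBoundary α σ w; linarith)
        (le_max_of_le_right (by change nextBoundary α σ w ≤ _; linarith))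
      linarith

open Classical in
theorem lateMiss_le {α : ℝ} (hα : 0 < α) (κ θ σ e t : ℝ) :
    (if LateHit α κ θ σ e t then 0 else 1 : ℤ) ≤
      (⌊(e - σ) / α⌋ - ⌊(min e (t + κ + θ) - σ) / α⌋) +
        (⌊(max (e - α) (t - α + θ) - σ) / α⌋ - ⌊(e - α - σ) / α⌋) := by
  have h1 := floor_sub_floor_nonneg (σ := σ) hα (min_le_left e (t + κ + θ))
  have h2 := floor_sub_floor_nonneg (σ := σ) hα (le_max_left (e - α) (t - α + θ))
  have hg1 := lt_lastBoundary hα σ e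
  have hg2 := lastBoundary_le hα σ e
  split_ifs with h
  · linarith
  · rw [LateHit, not_and_or, not_le, not_lt] at h
    rcases h with h | h
    · have := one_le_floor_sub_floor (σ := σ) (k := ⌊(e - σ) / α⌋) (B := e)
        (A := min e (t + κ + θ)) hα
        (lt_of_le_of_lt (min_le_right _ _) (by change _ < lastBoundary α σ e; linarith)) hg2
      linarith
    · have := one_le_floor_sub_floor (σ := σ) (k := ⌊(e - σ) / α⌋) (A := e - α)
        (B := max (e - α) (t - α + θ)) hα hg1
        (le_max_of_le_right (by change lastBoundary α σ e ≤ _; linarith))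
      linarith

/-- The shifts of the periods of length `3/4` by `j` of `r` hops from the starting point `i/4`. -/
noncomputable def gridStart (r i j : ℕ) : ℝ := (i : ℝ) / 4 + (j : ℝ) / r * (3 / 4)

/-- The number of period boundaries up to `y`, over the whole grid of period sets and relative to a
fixed origin. -/
noncomputable def boundaryCount (r : ℕ) (y : ℝ) : ℤ :=
  ∑ i ∈ Finset.range 3, ∑ j ∈ Finset.range r, ⌊(y - gridStart r i j) / (3 / 4)⌋

theorem boundaryCount_mono (r : ℕ) {y z : ℝ} (h : y ≤ z) :
    boundaryCount r y ≤ boundaryCount r z := by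
  unfold boundaryCount
  gcongr

theorem boundaryCount_add_quarter (r : ℕ) (y : ℝ) :
    boundaryCount r (y + 1 / 4) = boundaryCount r y + r := by
  have h0 : ∀ j, ⌊(y + 1 / 4 - gridStart r 0 j) / (3 / 4)⌋ =
      ⌊(y - gridStart r 2 j) / (3 / 4)⌋ + 1 := fun j => by
    rw [← Int.floor_add_one]; congr 1; unfold gridStart; push_cast; ring
  have h1 : ∀ j, ⌊(y + 1 / 4 - gridStart r 1 j) / (3 / 4)⌋ =
      ⌊(y - gridStart r 0 j) / (3 / 4)⌋ := fun j => by
    congr 1; unfold gridStart; push_cast; ring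
  have h2 : ∀ j, ⌊(y + 1 / 4 - gridStart r 2 j) / (3 / 4)⌋ =
      ⌊(y - gridStart r 1 j) / (3 / 4)⌋ := fun j => by
    congr 1; unfold gridStart; push_cast; ring
  simp only [boundaryCount, Finset.sum_range_succ, Finset.sum_range_zero, h0, h1, h2,
    Finset.sum_add_distrib, Finset.sum_const, Finset.card_range]
  simp
  ring

theorem boundaryCount_add_quarters (r : ℕ) (y : ℝ) (m : ℕ) :
    boundaryCount r (y + m / 4) = boundaryCount r y + m * r := by
  induction m with
  | zero => simp
  | succ m ih =>
    rw [show y + ((m + 1 : ℕ) : ℝ) / 4 = y + m / 4 + 1 / 4 by push_cast; ring,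
      boundaryCount_add_quarter, ih]
    push_cast
    ring

theorem boundaryCount_add_hop {r : ℕ} (hr : 0 < r) (y : ℝ) :
    boundaryCount r (y + 3 / 4 / r) = boundaryCount r y + 3 := by
  obtain ⟨k, rfl⟩ : ∃ k, r = k + 1 := ⟨r - 1, by omega⟩
  have hk : ((k + 1 : ℕ) : ℝ) ≠ 0 := by positivity
  have : ∀ i, ∑ j ∈ Finset.range (k + 1),
      ⌊(y + 3 / 4 / (k + 1 : ℕ) - gridStart (k + 1) i j) / (3 / 4)⌋ =
      ∑ j ∈ Finset.range (k + 1), ⌊(y - gridStart (k + 1) i j) / (3 / 4)⌋ + 1 := by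
    intro i
    rw [Finset.sum_range_succ', Finset.sum_range_succ, add_assoc]
    congr 1
    · refine Finset.sum_congr rfl fun j _ => ?_
      congr 1
      unfold gridStart
      push_cast
      field_simp
      ring
    · rw [← Int.floor_add_one]
      congr 1
      unfold gridStart
      push_cast at hk ⊢
      field_simp
      ring
  simp only [boundaryCount, this, Finset.sum_add_distrib]
  simp

theorem boundaryCount_add_hops {r : ℕ} (hr : 0 < r) (y : ℝ) (m : ℕ) :
    boundaryCount r (y + m * (3 / 4 / r)) = boundaryCount r y + 3 * m := by
  induction m with
  | zero => simp
  | succ m ih =>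
    rw [show y + ((m + 1 : ℕ) : ℝ) * (3 / 4 / r) = y + m * (3 / 4 / r) + 3 / 4 / r by
      push_cast; ring, boundaryCount_add_hop hr, ih]
    push_cast
    ring

open Classical in
/-- The number of period sets of the grid for which the early run misses a request. -/
noncomputable def earlyMisses (r : ℕ) (κ θ w t : ℝ) : ℤ :=
  ∑ i ∈ Finset.range 3, ∑ j ∈ Finset.range r,
    if EarlyHit (3 / 4) κ θ (gridStart r i j) w t then 0 else 1

open Classical in
/-- The number of period sets of the grid for which the late run misses a request. -/
noncomputable def lateMisses (r : ℕ) (κ θ e t : ℝ) : ℤ :=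
  ∑ i ∈ Finset.range 3, ∑ j ∈ Finset.range r,
    if LateHit (3 / 4) κ θ (gridStart r i j) e t then 0 else 1

theorem earlyMisses_le (r : ℕ) (κ θ w t : ℝ) : earlyMisses r κ θ w t ≤
    (boundaryCount r (max w (t - κ - θ)) - boundaryCount r w) +
      (boundaryCount r (w + 3 / 4) - boundaryCount r (min (w + 3 / 4) (t + 3 / 4 - θ))) := by
  unfold earlyMisses boundaryCount
  simp only [← Finset.sum_sub_distrib, ← Finset.sum_add_distrib]
  exact Finset.sum_le_sum fun i _ => Finset.sum_le_sum fun j _ =>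
    earlyMiss_le (by norm_num) κ θ _ w t

theorem lateMisses_le (r : ℕ) (κ θ e t : ℝ) : lateMisses r κ θ e t ≤
    (boundaryCount r e - boundaryCount r (min e (t + κ + θ))) +
      (boundaryCount r (max (e - 3 / 4) (t - 3 / 4 + θ)) - boundaryCount r (e - 3 / 4)) := by
  unfold lateMisses boundaryCount
  simp only [← Finset.sum_sub_distrib, ← Finset.sum_add_distrib]
  exact Finset.sum_le_sum fun i _ => Finset.sum_le_sum fun j _ =>
    lateMiss_le (by norm_num) κ θ _ e t

theorem earlyMisses_le_card (r : ℕ) (κ θ w t : ℝ) : earlyMisses r κ θ w t ≤ 3 * r := by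
  calc earlyMisses r κ θ w t ≤ ∑ i ∈ Finset.range 3, ∑ j ∈ Finset.range r, (1 : ℤ) :=
        Finset.sum_le_sum fun i _ => Finset.sum_le_sum fun j _ => by split_ifs <;> norm_num
    _ = 3 * r := by simp

theorem lateMisses_le_card (r : ℕ) (κ θ e t : ℝ) : lateMisses r κ θ e t ≤ 3 * r := by
  calc lateMisses r κ θ e t ≤ ∑ i ∈ Finset.range 3, ∑ j ∈ Finset.range r, (1 : ℤ) :=
        Finset.sum_le_sum fun i _ => Finset.sum_le_sum fun j _ => by split_ifs <;> norm_num
    _ = 3 * r := by simp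

theorem misses_le_of_middle (r : ℕ) {κ θ w e t : ℝ} (hl : e - w ≤ 2) (hw : w + θ ≤ t)
    (he : t + θ ≤ e) : earlyMisses r κ θ w t + lateMisses r κ θ e t ≤
      max (3 * r : ℤ)
        (8 * r - (boundaryCount r (t + κ + θ) - boundaryCount r (t - κ - θ))) := by
  have h1 := earlyMisses_le r κ θ w t
  have h2 := lateMisses_le r κ θ e t
  have h1' := earlyMisses_le_card r κ θ w t
  have h2' := lateMisses_le_card r κ θ e t
  rw [min_eq_left (show w + 3 / 4 ≤ t + 3 / 4 - θ by linarith), sub_self, add_zero] at h1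
  rw [max_eq_left (show t - 3 / 4 + θ ≤ e - 3 / 4 by linarith), sub_self, add_zero] at h2
  rcases le_total (t - κ - θ) w with h | h
  · rw [max_eq_left h, sub_self] at h1
    exact le_max_of_le_left (by linarith)
  rcases le_total e (t + κ + θ) with h' | h'
  · rw [min_eq_left h', sub_self] at h2
    exact le_max_of_le_left (by linarith)
  rw [max_eq_right h] at h1
  rw [min_eq_right h'] at h2
  have h3 : boundaryCount r e ≤ boundaryCount r w + 8 * r := by
    rw [← Nat.cast_ofNat (n := 8), ← boundaryCount_add_quarters]
    exact boundaryCount_mono r (by push_cast; linarith)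
  exact le_max_of_le_right (by linarith)

theorem boundaryCount_sub_of_two_mul {q r : ℕ} (hr : 0 < r) (hq : r ≤ q) {κ : ℝ}
    (hκ : κ = 3 / 4 * ((q : ℝ) / r - 1) / 2) (t : ℝ) :
    boundaryCount r (t + κ) = boundaryCount r (t - κ) + 3 * (q - r) := by
  have := boundaryCount_add_hops hr (t - κ) (q - r)
  rw [Nat.cast_sub hq, Nat.cast_sub hq] at this
  rw [← this]
  congr 1
  have : (r : ℝ) ≠ 0 := by positivity
  rw [hκ]
  field_simp
  ring

theorem misses_zero_le {q r : ℕ} (hr : 0 < r) (hq : r ≤ q) {κ : ℝ}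
    (hκ : κ = 3 / 4 * ((q : ℝ) / r - 1) / 2) {w e t : ℝ} (hl : e - w ≤ 2) (hw : w ≤ t)
    (he : t ≤ e) : earlyMisses r κ 0 w t + lateMisses r κ 0 e t ≤
      max (3 * r : ℤ) (11 * r - 3 * q) := by
  have := misses_le_of_middle r (κ := κ) (θ := 0) hl (by linarith) (by linarith)
  rw [add_zero, sub_zero, boundaryCount_sub_of_two_mul hr hq hκ] at this
  refine this.trans_eq ?_
  congr 1
  ring

theorem misses_add_misses_le {q r : ℕ} (hr : 0 < r) (hq : 2 * r ≤ q) {κ : ℝ}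
    (hκ : κ = 3 / 4 * ((q : ℝ) / r - 1) / 2) {w e t : ℝ} (hl : e - w ≤ 2) (hw : w ≤ t)
    (he : t ≤ e) : earlyMisses r κ 0 w t + lateMisses r κ 0 e t +
      (earlyMisses r κ (1 / 4) w t + lateMisses r κ (1 / 4) e t) ≤
        max (7 * r : ℤ) (14 * r - 3 * q) := by
  have hκ' : 1 / 4 ≤ κ := by
    have : (2 : ℝ) ≤ (q : ℝ) / r := by
      rw [le_div_iff₀ (by positivity)]; exact_mod_cast hq
    rw [hκ]; linarith
  have h0 := misses_zero_le hr (by omega) hκ hl hw he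
  have e0 := earlyMisses_le r κ 0 w t
  have l0 := lateMisses_le r κ 0 e t
  have e1 := earlyMisses_le r κ (1 / 4) w t
  have l1 := lateMisses_le r κ (1 / 4) e t
  have e0' := earlyMisses_le_card r κ 0 w t
  have l0' := lateMisses_le_card r κ 0 e t
  have e1' := earlyMisses_le_card r κ (1 / 4) w t
  have l1' := lateMisses_le_card r κ (1 / 4) e t
  rcases lt_or_ge t (w + 1 / 4) with h | h
  · rw [max_eq_left (by linarith), min_eq_left (by linarith)] at e0
    rw [max_eq_left (by linarith)] at e1
    have := boundaryCount_mono r (show w + 3 / 4 - 1 / 4 ≤ min (w + 3 / 4) (t + 3 / 4 - 1 / 4) from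
      le_min (by linarith) (by linarith))
    have hs := boundaryCount_add_quarter r (w + 3 / 4 - 1 / 4)
    rw [sub_add_cancel] at hs
    exact le_max_of_le_left (by linarith)
  rcases lt_or_ge e (t + 1 / 4) with h' | h'
  · rw [max_eq_left (by linarith), min_eq_left (by linarith)] at l0
    rw [min_eq_left (by linarith)] at l1
    have := boundaryCount_mono r (show max (e - 3 / 4) (t - 3 / 4 + 1 / 4) ≤ e - 3 / 4 + 1 / 4 from
      max_le (by linarith) (by linarith))
    have hs := boundaryCount_add_quarter r (e - 3 / 4)
    exact le_max_of_le_left (by linarith)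
  have hm := misses_le_of_middle r (κ := κ) (θ := 1 / 4) hl h h'
  rw [boundaryCount_add_quarter, boundaryCount_sub_of_two_mul hr (by omega) hκ] at hm
  have hs := boundaryCount_add_quarter r (t - κ - 1 / 4)
  rw [sub_add_cancel] at hs
  have hq' : (2 * r : ℤ) ≤ q := by exact_mod_cast hq
  omega

open Classical in
/-- If for all period sets of the grid each of the four runs services at most `G` requests, then a
unit-speed run services at most `(23 - 7 s) / (1 + 3 s - s ^ 2)` times as many. -/
theorem card_mul_le_of_runs {n : ℕ} (O : Finset (Fin n)) (w e t : Fin n → ℝ) {q r : ℕ}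
    (hr : 0 < r) (h1 : (17 / 7 : ℝ) ≤ (q : ℝ) / r) (h2 : (q : ℝ) / r ≤ 3)
    (hl : ∀ i ∈ O, e i - w i ≤ 2) (hw : ∀ i ∈ O, w i ≤ t i) (he : ∀ i ∈ O, t i ≤ e i) {κ G : ℝ}
    (hκ : κ = 3 / 4 * ((q : ℝ) / r - 1) / 2)
    (hearly : ∀ i < 3, ∀ j < r, ∀ θ, ((O.filter fun a =>
      EarlyHit (3 / 4) κ θ (gridStart r i j) (w a) (t a)).card : ℝ) ≤ G)
    (hlate : ∀ i < 3, ∀ j < r, ∀ θ, ((O.filter fun a =>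
      LateHit (3 / 4) κ θ (gridStart r i j) (e a) (t a)).card : ℝ) ≤ G) :
    O.card * (1 + 3 * ((q : ℝ) / r) - ((q : ℝ) / r) ^ 2) ≤ (23 - 7 * ((q : ℝ) / r)) * G := by
  have hr' : (0 : ℝ) < r := by exact_mod_cast hr
  have count : ∀ (p : ℕ → ℕ → Fin n → Prop), (∀ i < 3, ∀ j < r,
      ((O.filter (p i j)).card : ℝ) ≤ G) →
      (O.card : ℝ) * (3 * r) - ((∑ a ∈ O, ∑ i ∈ Finset.range 3, ∑ j ∈ Finset.range r,
        (if p i j a then 0 else 1 : ℤ) : ℤ) : ℝ) ≤ 3 * r * G := by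
    intro p hp
    have hc : ∀ i ∈ Finset.range 3, ∀ j ∈ Finset.range r,
        (O.card : ℝ) - G ≤ ∑ a ∈ O, (if p i j a then 0 else 1 : ℝ) := by
      intro i hi j hj
      have := hp i (Finset.mem_range.1 hi) j (Finset.mem_range.1 hj)
      have e1 : ∑ a ∈ O, (if p i j a then 0 else 1 : ℝ) =
          (O.filter fun a => ¬ p i j a).card := by
        rw [Finset.card_filter]
        push_cast
        exact Finset.sum_congr rfl fun a _ => by split_ifs <;> simp_all
      have e2 : ((O.filter (p i j)).card : ℝ) + (O.filter fun a => ¬ p i j a).card = O.card := by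
        exact_mod_cast Finset.card_filter_add_card_filter_not (s := O) (p i j)
      rw [e1]
      linarith
    have hsum := Finset.sum_le_sum fun i hi => Finset.sum_le_sum (hc i hi)
    simp only [Finset.sum_const, Finset.card_range, nsmul_eq_mul] at hsum
    rw [Finset.sum_comm]
    simp_rw [Finset.sum_comm (s := O)]
    push_cast
    push_cast at hsum
    linarith
  have cE := fun θ => count (fun i j a => EarlyHit (3 / 4) κ θ (gridStart r i j) (w a) (t a))
    fun i hi j hj => hearly i hi j hj θ
  have cL := fun θ => count (fun i j a => LateHit (3 / 4) κ θ (gridStart r i j) (e a) (t a))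
    fun i hi j hj => hlate i hi j hj θ
  set s : ℝ := (q : ℝ) / r with hs
  have hqs : (q : ℝ) = s * r := by rw [hs]; field_simp
  have hN : (0 : ℝ) ≤ O.card := Nat.cast_nonneg _
  have hnum : 0 < 23 - 7 * s := by linarith
  have h2r : 2 * r ≤ q := by
    have : (2 * r : ℝ) ≤ q := by rw [hqs]; nlinarith
    exact_mod_cast this
  -- it suffices to bound the fraction of hits from below
  have fin : ∀ x : ℝ, O.card * (x * r) ≤ r * G → 1 + 3 * s - s ^ 2 ≤ x * (23 - 7 * s) →
      O.card * (1 + 3 * s - s ^ 2) ≤ (23 - 7 * s) * G := by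
    intro x hx hx'
    have : O.card * x ≤ G := by
      have : r * (O.card * x) ≤ r * G := by linarith
      exact le_of_mul_le_mul_left this hr'
    nlinarith
  rcases le_total (5 / 2) s with h | h
  · have hsum : ((∑ a ∈ O, (earlyMisses r κ 0 (w a) (t a) + lateMisses r κ 0 (e a) (t a)) : ℤ) : ℝ)
        ≤ O.card * max (3 * r : ℝ) (11 * r - 3 * q) := by
      have := Finset.sum_le_card_nsmul O _ _ fun a ha =>
        misses_zero_le hr (by omega) hκ (hl a ha) (hw a ha) (he a ha)
      rw [nsmul_eq_mul] at this
      have := (Int.cast_le (R := ℝ)).2 this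
      simpa using this
    rw [Finset.sum_add_distrib] at hsum
    have a1 := cE 0
    have a2 := cL 0
    unfold earlyMisses lateMisses at hsum
    push_cast at hsum a1 a2
    rcases le_total (3 * r : ℝ) (11 * r - 3 * q) with hm | hm
    · rw [max_eq_right hm, hqs] at hsum
      exact fin ((3 * s - 5) / 6) (by linarith) (by nlinarith)
    · rw [max_eq_left hm] at hsum
      exact fin (1 / 2) (by linarith) (by nlinarith)
  · have hsum : ((∑ a ∈ O, (earlyMisses r κ 0 (w a) (t a) + lateMisses r κ 0 (e a) (t a) +
        (earlyMisses r κ (1 / 4) (w a) (t a) + lateMisses r κ (1 / 4) (e a) (t a))) : ℤ) : ℝ)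
        ≤ O.card * max (7 * r : ℝ) (14 * r - 3 * q) := by
      have := Finset.sum_le_card_nsmul O _ _ fun a ha =>
        misses_add_misses_le hr h2r hκ (hl a ha) (hw a ha) (he a ha)
      rw [nsmul_eq_mul] at this
      have := (Int.cast_le (R := ℝ)).2 this
      simpa using this
    rw [Finset.sum_add_distrib, Finset.sum_add_distrib, Finset.sum_add_distrib] at hsum
    have a1 := cE 0
    have a2 := cL 0
    have a3 := cE (1 / 4)
    have a4 := cL (1 / 4)
    unfold earlyMisses lateMisses at hsum
    push_cast at hsum a1 a2 a3 a4
    rcases le_total (7 * r : ℝ) (14 * r - 3 * q) with hm | hm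
    · rw [max_eq_right hm, hqs] at hsum
      exact fin ((3 * s - 2) / 12) (by linarith) (by nlinarith)
    · rw [max_eq_left hm] at hsum
      exact fin (5 / 12) (by linarith) (by nlinarith)

/-! ### The sets of periods tried by SPEEDUP -/

theorem distinctUpTo_some {cap : Option ℕ} {l acc l' : List ℝ}
    (h : (distinctUpTo cap l acc).val = some l') :
    (∀ x ∈ l, x ∈ l') ∧ (∀ x ∈ acc, x ∈ l') ∧ (∀ x ∈ l', x ∈ acc ∨ x ∈ l) ∧
      (acc.Nodup → l'.Nodup) ∧ ∀ r, cap = some r → acc.length ≤ r → l'.length ≤ r := by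
  induction l generalizing acc with
  | nil =>
    obtain rfl : acc = l' := by simpa [distinctUpTo] using h
    simp
  | cons x l ih =>
    simp only [distinctUpTo, Timed.val_bind] at h
    split_ifs at h with h1 h2
    · obtain ⟨a, b, c, d, e⟩ := ih h
      refine ⟨?_, b, ?_, d, e⟩
      · simpa using ⟨b x h1, a⟩
      · intro y hy
        rcases c y hy with h | h <;> simp [h]
    · obtain ⟨a, b, c, d, e⟩ := ih h
      refine ⟨?_, fun y hy => b y (by simp [hy]), ?_, fun hn => d (by simp [h1, hn]), ?_⟩
      · simpa using ⟨b x (by simp), a⟩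
      · intro y hy
        rcases c y hy with h | h
        · rcases List.mem_cons.1 h with rfl | h <;> simp [*]
        · simp [h]
      · intro r hr hle
        refine e r hr ?_
        have : r ≠ acc.length := fun h => h2 (by rw [hr, h])
        simp only [List.length_cons]
        omega

theorem distinctUpTo_none {cap : Option ℕ} {l acc : List ℝ}
    (h : (distinctUpTo cap l acc).val = none) (hn : acc.Nodup) :
    ∃ r, cap = some r ∧ ∃ l' : List ℝ, l'.Nodup ∧ (∀ x ∈ l', x ∈ acc ∨ x ∈ l) ∧ r ≤ l'.length := by
  induction l generalizing acc with
  | nil => simp [distinctUpTo] at h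
  | cons x l ih =>
    simp only [distinctUpTo, Timed.val_bind] at h
    split_ifs at h with h1 h2
    · obtain ⟨r, hr, l', a, b, c⟩ := ih h hn
      exact ⟨r, hr, l', a, fun y hy => (b y hy).imp_right fun h => by simp [h], c⟩
    · exact ⟨_, h2, acc, hn, fun y hy => .inl hy, le_rfl⟩
    · obtain ⟨r, hr, l', a, b, c⟩ := ih h (by simp [h1, hn])
      refine ⟨r, hr, l', a, fun y hy => ?_, c⟩
      rcases b y hy with h | h
      · rcases List.mem_cons.1 h with rfl | h <;> simp [*]
      · simp [h]

theorem cost_distinctUpTo_le {cap : Option ℕ} {l acc : List ℝ} {K : ℕ} (hn : acc.Nodup)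
    (hK : (∀ l' : List ℝ, l'.Nodup → (∀ x ∈ l', x ∈ acc ∨ x ∈ l) → l'.length ≤ K) ∨
      (cap = some K ∧ acc.length ≤ K)) :
    (distinctUpTo cap l acc).cost ≤ l.length * (K + 1) := by
  induction l generalizing acc with
  | nil => simp [distinctUpTo]
  | cons x l ih =>
    have hacc : acc.length ≤ K := by
      rcases hK with h | h
      · exact h acc hn fun x hx => .inl hx
      · exact h.2
    simp only [distinctUpTo, Timed.cost_bind, Timed.cost_tick, List.length_cons, add_mul, one_mul]
    have : ∀ m, m ≤ l.length * (K + 1) → acc.length + 1 + m ≤ l.length * K + l.length + (K + 1) := by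
      intro m hm
      rw [mul_add, mul_one] at hm
      omega
    rw [mul_add, mul_one]
    split_ifs with h1 h2
    · refine this _ (ih hn (hK.imp_left fun h l' a b => h l' a fun y hy => ?_))
      exact (b y hy).imp_right fun h => by simp [h]
    · simpa using this 0 (Nat.zero_le _)
    · refine this _ (ih (by simp [h1, hn]) ?_)
      rcases hK with h | h
      · refine .inl fun l' a b => h l' a fun y hy => ?_
        rcases b y hy with h | h
        · rcases List.mem_cons.1 h with rfl | h <;> simp [*]
        · simp [h]
      · refine .inr ⟨h.1, ?_⟩
        have : K ≠ acc.length := fun h' => h2 (by rw [h.1, h'])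
        simp only [List.length_cons]
        omega

section Starts

variable {X : Type u}

/-- The relative positions at which windows start or end within the periods. -/
noncomputable def shiftList (I : Instance X) (α base : ℝ) : List ℝ :=
  (List.finRange I.n).flatMap fun i =>
    [Int.fract ((I.opens i - base) / α), Int.fract ((I.closes i - base) / α)]

theorem mem_shiftList {I : Instance X} {α base y : ℝ} : y ∈ shiftList I α base ↔
    ∃ i, y = Int.fract ((I.opens i - base) / α) ∨ y = Int.fract ((I.closes i - base) / α) := by
  simp [shiftList]

theorem length_shiftList (I : Instance X) (α base : ℝ) :
    (shiftList I α base).length = 2 * I.n := by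
  simp [shiftList, List.length_flatMap, mul_comm]

theorem periodStarts_cases (I : Instance X) (S : Speedup) (α base : ℝ) :
    (∃ l : List ℝ, (distinctUpTo S.hops (shiftList I α base) []).val = some l ∧
      (periodStarts I S α base).val = l.map (fun x => base + x * α) ∧
      (periodStarts I S α base).cost =
        I.n + 1 + ((distinctUpTo S.hops (shiftList I α base) []).cost + (l.length + 1))) ∨
    (∃ r : ℕ, (distinctUpTo S.hops (shiftList I α base) []).val = none ∧ S.hops = some r ∧
      (periodStarts I S α base).val = (List.range r).map (fun j : ℕ => base + (j : ℝ) / r * α) ∧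
      (periodStarts I S α base).cost =
        I.n + 1 + ((distinctUpTo S.hops (shiftList I α base) []).cost + (r + 1))) := by
  have hv : (periodStarts I S α base) = (do
      tick (I.n + 1)
      let shifts ← distinctUpTo S.hops (shiftList I α base) []
      match shifts, S.hops with
      | some l, _ => do
        tick (l.length + 1)
        pure (l.map fun x => base + x * α)
      | none, some r => do
        tick (r + 1)
        pure ((List.range r).map fun j => base + (j : ℝ) / r * α)
      | none, none => pure []) := rfl
  rw [hv]
  simp only [Timed.val_bind, Timed.cost_bind, Timed.cost_tick]
  cases h : (distinctUpTo S.hops (shiftList I α base) []).val with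
  | some l =>
    exact .inl ⟨l, rfl, rfl, by simp⟩
  | none =>
    obtain ⟨r, hr, -⟩ := distinctUpTo_none h List.nodup_nil
    refine .inr ⟨r, rfl, hr, ?_, ?_⟩
    · rw [hr]; simp [← List.map_eq_flatMap, Function.comp_def]
    · rw [hr]; simp

theorem periodStarts_bounds {I : Instance X} {S : Speedup} {α base : ℝ} {K : ℕ}
    (hK : (∀ l' : List ℝ, l'.Nodup → (∀ x ∈ l', x ∈ shiftList I α base) → l'.length ≤ K) ∨
      S.hops = some K) :
    (periodStarts I S α base).val.length ≤ K ∧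
      (periodStarts I S α base).cost ≤ I.n + 1 + (2 * I.n * (K + 1) + (K + 1)) := by
  have hc : (distinctUpTo S.hops (shiftList I α base) []).cost ≤ 2 * I.n * (K + 1) := by
    rw [← length_shiftList I α base]
    refine cost_distinctUpTo_le List.nodup_nil ?_
    rcases hK with h | h
    · exact .inl fun l' a b => h l' a fun y hy => by simpa using b y hy
    · exact .inr ⟨h, Nat.zero_le _⟩
  rcases periodStarts_cases I S α base with ⟨l, hl, hv, hcost⟩ | ⟨r, hl, hr, hv, hcost⟩
  · obtain ⟨-, -, hsub, hnd, hcap⟩ := distinctUpTo_some hl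
    have : l.length ≤ K := by
      rcases hK with h | h
      · exact h l (hnd List.nodup_nil) fun y hy => by simpa using hsub y hy
      · exact hcap K h (Nat.zero_le _)
    rw [hv, hcost, List.length_map]
    exact ⟨this, by omega⟩
  · have : r ≤ K := by
      rcases hK with h | h
      · obtain ⟨r', hr', l', a, b, c⟩ := distinctUpTo_none hl List.nodup_nil
        rw [hr, Option.some.injEq] at hr'
        rw [hr']
        exact c.trans (h l' a fun y hy => by simpa using b y hy)
      · rw [hr, Option.some.injEq] at h
        exact h.le
    rw [hv, hcost, List.length_map, List.length_range]
    exact ⟨this, by omega⟩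

theorem card_fullPeriods (α σ w e : ℝ) :
    (fullPeriods α σ w e).card = (⌊(e - σ) / α⌋ - ⌊(w - σ) / α⌋ - 1).toNat := by
  rw [fullPeriods, Int.card_Ico]
  congr 1
  ring

/-- Moving the starting point to the right up to the next boundary of a window does not change the
periods that the windows fill. -/
theorem exists_equivalent_start {I : Instance X} (hn : 0 < I.n) {α : ℝ} (hα : 0 < α)
    (base σ : ℝ) : ∃ y ∈ shiftList I α base, ∃ (z : ℤ) (δ : ℝ), base + y * α = σ + δ + z * α ∧
      ∀ i, ⌊(I.opens i - (base + y * α)) / α⌋ = ⌊(I.opens i - σ) / α⌋ - z ∧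
        ⌊(I.closes i - (base + y * α)) / α⌋ = ⌊(I.closes i - σ) / α⌋ - z := by
  set E : Finset ℝ := Finset.univ.image I.opens ∪ Finset.univ.image I.closes with hE
  have ho : ∀ i, I.opens i ∈ E := fun i => by simp [hE]
  have hc : ∀ i, I.closes i ∈ E := fun i => by simp [hE]
  obtain ⟨x, hx, hmin⟩ := E.exists_min_image (fun x => Int.fract ((x - σ) / α))
    ⟨_, ho ⟨0, hn⟩⟩
  set z : ℤ := ⌊(x - σ) / α⌋ - ⌊(x - base) / α⌋ with hz
  have hxσ : Int.fract ((x - σ) / α) = (x - σ) / α - ⌊(x - σ) / α⌋ := rfl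
  have hxb : Int.fract ((x - base) / α) = (x - base) / α - ⌊(x - base) / α⌋ := rfl
  have hstart : base + Int.fract ((x - base) / α) * α =
      σ + Int.fract ((x - σ) / α) * α + z * α := by
    rw [hxσ, hxb, hz]
    push_cast
    field_simp
    ring
  have hfloor : ∀ x' ∈ E, ⌊(x' - (base + Int.fract ((x - base) / α) * α)) / α⌋ =
      ⌊(x' - σ) / α⌋ - z := by
    intro x' hx'
    have h1 : (x' - (base + Int.fract ((x - base) / α) * α)) / α =
        (⌊(x' - σ) / α⌋ : ℝ) + (Int.fract ((x' - σ) / α) - Int.fract ((x - σ) / α)) - z := by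
      rw [hstart, show Int.fract ((x' - σ) / α) = (x' - σ) / α - ⌊(x' - σ) / α⌋ from rfl]
      field_simp
      ring
    have h2 := hmin x' hx'
    have h3 := Int.fract_lt_one ((x' - σ) / α)
    have h4 := Int.fract_nonneg ((x - σ) / α)
    rw [h1, Int.floor_sub_intCast, Int.floor_intCast_add]
    have : ⌊Int.fract ((x' - σ) / α) - Int.fract ((x - σ) / α)⌋ = 0 :=
      Int.floor_eq_zero_iff.2 ⟨by linarith, by linarith⟩
    rw [this, add_zero]
  refine ⟨Int.fract ((x - base) / α), ?_, z, Int.fract ((x - σ) / α) * α, hstart,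
    fun i => ⟨hfloor _ (ho i), hfloor _ (hc i)⟩⟩
  rw [mem_shiftList]
  rcases Finset.mem_union.1 hx with h | h <;> obtain ⟨i, -, rfl⟩ := Finset.mem_image.1 h
  · exact ⟨i, .inl rfl⟩
  · exact ⟨i, .inr rfl⟩

end Starts

/-! ### The runs found by SPEEDUP -/

section Runs

variable {X : Type u} [MetricSpace X] {F : PathFinder X} {γ : ℝ} {I : Instance X} {S : Speedup}

/-- The recorded profit is earned by a service run at the given speed. -/
def Sound (I : Instance X) (v : ℝ) (best : ℕ × List (Fin I.n × ℝ)) : Prop :=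
  IsRun I.loc v best.2 ∧ best.1 ≤ profit I best.2

theorem sound_empty (I : Instance X) (v : ℝ) : Sound I v (0, []) :=
  ⟨List.isChain_nil, Nat.zero_le _⟩

theorem Sound.retain {v : ℝ} {best new : ℕ × List (Fin I.n × ℝ)} (hb : Sound I v best)
    (hn : Sound I v new) : Sound I v (retain best new) := by
  unfold Repairman.retain
  split_ifs <;> assumption

theorem le_retain_left {n : ℕ} (best new : ℕ × List (Fin n × ℝ)) :
    best.1 ≤ (retain best new).1 := by
  unfold retain
  split_ifs with h
  · exact h.le
  · exact le_rfl

theorem le_retain_right {n : ℕ} (best new : ℕ × List (Fin n × ℝ)) :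
    new.1 ≤ (retain best new).1 := by
  unfold retain
  split_ifs with h
  · exact le_rfl
  · exact not_lt.1 h

/-- Windows are trimmed to periods that they fill. -/
def ValidChoice (choice : ℕ → Option ℕ) : Prop := ∀ l j, choice l = some j → 1 ≤ j ∧ j ≤ l

theorem trim_eq {X : Type u} (I : Instance X) (α σ : ℝ) (choice : ℕ → Option ℕ) (i : Fin I.n) :
    trim I α σ choice i = (choice (fullPeriods α σ (I.opens i) (I.closes i)).card).map
      fun j : ℕ => ⌊(I.opens i - σ) / α⌋ + (j : ℤ) := by
  unfold trim
  cases choice (fullPeriods α σ (I.opens i) (I.closes i)).card <;> rfl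

theorem window_of_trim {X : Type u} {I : Instance X} {α : ℝ} (hα : 0 < α) {σ : ℝ} {choice : ℕ → Option ℕ}
    (hch : ValidChoice choice) {i : Fin I.n} {c : ℤ} (h : trim I α σ choice i = some c) :
    I.opens i < σ + c * α ∧ σ + (c + 1) * α ≤ I.closes i := by
  rw [← mem_fullPeriods hα]
  rw [trim_eq, Option.map_eq_some_iff] at h
  obtain ⟨j, hj, rfl⟩ := h
  obtain ⟨h1, h2⟩ := hch _ _ hj
  rw [card_fullPeriods] at h2
  rw [fullPeriods, Finset.mem_Ico]
  omega

theorem repairman_trim_sound (hF : F.Approximates γ) {v α : ℝ} (hv : 0 < v) (hα : 0 < α) (σ : ℝ)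
    {choice : ℕ → Option ℕ} (hch : ValidChoice choice) :
    Sound I v (repairman F I.loc v α σ (trim I α σ choice)).val := by
  obtain ⟨hrun, hmem, hcard⟩ := repairman_sound hF I.loc σ hv hα (trim I α σ choice)
  refine ⟨hrun, hcard.trans ?_⟩
  classical
  unfold profit
  refine Finset.card_le_card fun i hi => ?_
  rw [List.mem_toFinset, List.mem_map] at hi
  obtain ⟨⟨i', t⟩, hx, rfl⟩ := hi
  obtain ⟨c, hc, h1, h2⟩ := hmem _ hx
  have := window_of_trim hα hch hc
  rw [Finset.mem_filter]
  exact ⟨Finset.mem_univ _, t, hx, by linarith [this.1], by linarith [this.2]⟩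

theorem speedup_sound (hF : F.Approximates γ) (hv : 0 < S.val) {α : ℝ} (hα : 0 < α) (base : ℝ)
    {choice : ℕ → Option ℕ} (hch : ValidChoice choice) :
    Sound I S.val (speedup F I S α base choice).val := by
  unfold speedup
  rw [Timed.val_bind]
  refine Timed.foldlM_induction (Sound I S.val) _ _ _ (sound_empty I _) fun b hb σ _ => ?_
  exact hb.retain (repairman_trim_sound hF hv hα σ hch)

theorem le_speedup {α base σ : ℝ} {choice : ℕ → Option ℕ}
    (hσ : σ ∈ (periodStarts I S α base).val) :
    (repairman F I.loc S.val α σ (trim I α σ choice)).val.1 ≤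
      (speedup F I S α base choice).val.1 := by
  unfold speedup
  rw [Timed.val_bind]
  refine Timed.foldlM_reach (fun _ => True)
    (fun b : ℕ × List (Fin I.n × ℝ) =>
      (repairman F I.loc S.val α σ (trim I α σ choice)).val.1 ≤ b.1) _ _ _ trivial
    (fun _ _ _ _ => trivial) hσ ?_ ?_
  · intro b _
    exact le_retain_right _ _
  · intro b hb σ' _
    exact hb.trans (le_retain_left _ _)

theorem Serviceable.of_equivalent_start {v α σ σ' δ : ℝ} {z : ℤ} {choice : ℕ → Option ℕ}
    {H : Finset (Fin I.n)} {τ : Fin I.n → ℝ} (hσ : σ' = σ + δ + z * α)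
    (hfl : ∀ i, ⌊(I.opens i - σ') / α⌋ = ⌊(I.opens i - σ) / α⌋ - z ∧
        ⌊(I.closes i - σ') / α⌋ = ⌊(I.closes i - σ) / α⌋ - z)
    (hH : Serviceable I.loc v α σ (trim I α σ choice) H τ) :
    Serviceable I.loc v α σ' (trim I α σ' choice) H fun i => τ i + δ := by
  refine ⟨fun i hi => ?_, fun i hi j hj => ?_⟩
  · obtain ⟨c, hc, h1, h2⟩ := hH.mem i hi
    refine ⟨c - z, ?_, ?_, ?_⟩
    · rw [trim_eq, Option.map_eq_some_iff] at hc ⊢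
      obtain ⟨j, hj, rfl⟩ := hc
      refine ⟨j, ?_, ?_⟩
      · rw [← hj, card_fullPeriods, card_fullPeriods, (hfl i).1, (hfl i).2]
        congr 2
        ring
      · rw [(hfl i).1]
        ring
    · rw [hσ]; push_cast; linarith
    · rw [hσ]; push_cast; linarith
  · simpa using hH.dist_le i hi j hj

/-- SPEEDUP does, up to the factor `γ`, as well as any run for windows trimmed according to one of the
sets of periods obtained by hops. -/
theorem speedup_complete_hops (hF : F.Approximates γ) (hγ : 0 ≤ γ) (hv : 0 < S.val) {α base : ℝ}
    (hα : 0 < α) {choice : ℕ → Option ℕ} {σ : ℝ}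
    (hσ : ∀ r, S.hops = some r → ∃ j < r, σ = base + (j : ℝ) / r * α) {H : Finset (Fin I.n)}
    {τ : Fin I.n → ℝ} (hH : Serviceable I.loc S.val α σ (trim I α σ choice) H τ) :
    (H.card : ℝ) ≤ γ * (speedup F I S α base choice).val.1 := by
  rcases H.eq_empty_or_nonempty with rfl | ⟨a, -⟩
  · simp only [Finset.card_empty, Nat.cast_zero]; positivity
  have step : ∀ σ' ∈ (periodStarts I S α base).val, ∀ τ',
      Serviceable I.loc S.val α σ' (trim I α σ' choice) H τ' →
      (H.card : ℝ) ≤ γ * (speedup F I S α base choice).val.1 := by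
    intro σ' hmem τ' hH'
    refine (repairman_complete hF hγ hv hα hH').trans ?_
    have := le_speedup (F := F) (choice := choice) hmem
    gcongr
  rcases periodStarts_cases I S α base with ⟨l, hl, hst, -⟩ | ⟨r, -, hr, hst, -⟩
  · obtain ⟨y, hy, z, δ, hz, hfl⟩ := exists_equivalent_start (Fin.pos a) hα base σ
    refine step (base + y * α) ?_ _ (hH.of_equivalent_start hz hfl)
    rw [hst]
    exact List.mem_map_of_mem ((distinctUpTo_some hl).1 y hy)
  · obtain ⟨j, hj, hσj⟩ := hσ r hr
    refine step σ ?_ _ hH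
    rw [hst, List.mem_map]
    exact ⟨j, List.mem_range.2 hj, hσj.symm⟩

theorem validChoice_of_mem_calls {c : ℝ × ℝ × (ℕ → Option ℕ)} (hc : c ∈ calls) :
    0 < c.1 ∧ ValidChoice c.2.2 := by
  have h3 : ∀ j k, 1 ≤ j → j ≤ 2 → 1 ≤ k → k ≤ 3 → ValidChoice (choice₃ j k) := by
    intro j k _ _ _ _ l m h
    unfold choice₃ at h
    split at h <;> simp at h <;> omega
  have h2 : ∀ j, 1 ≤ j → j ≤ 2 → ValidChoice (choice₂ j) := by
    intro j _ _ l m h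
    unfold choice₂ at h
    split at h <;> simp at h <;> omega
  have h1 : ValidChoice choice₁ := by
    intro l m h
    unfold choice₁ at h
    split at h <;> simp at h
    omega
  simp only [calls, List.mem_append, List.mem_flatMap, List.mem_map, List.mem_cons,
    List.not_mem_nil, or_false] at hc
  rcases hc with (⟨i, -, j, hj, k, hk, rfl⟩ | ⟨i, -, j, hj, rfl⟩) | ⟨i, -, rfl⟩
  · exact ⟨by norm_num, h3 j k (by omega) (by omega) (by omega) (by omega)⟩
  · exact ⟨by norm_num, h2 j (by omega) (by omega)⟩
  · exact ⟨by norm_num, h1⟩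

theorem exists_speedupW12_eq (hF : F.Approximates γ) (I : Instance X) (hv : 0 < S.val) :
    ∃ best : ℕ × List (Fin I.n × ℝ), (speedupW12 F I S).val = best.2 ∧ Sound I S.val best ∧
      ∀ c ∈ calls, (speedup F I S c.1 c.2.1 c.2.2).val.1 ≤ best.1 := by
  refine ⟨_, rfl, ?_, fun c hc => ?_⟩
  · refine Timed.foldlM_induction (Sound I S.val) _ _ _ (sound_empty I _) fun b hb c hc => ?_
    obtain ⟨h1, h2⟩ := validChoice_of_mem_calls hc
    exact hb.retain (speedup_sound hF hv h1 _ h2)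
  · refine Timed.foldlM_reach (fun _ => True) (fun b : ℕ × List (Fin I.n × ℝ) =>
      (speedup F I S c.1 c.2.1 c.2.2).val.1 ≤ b.1) _ _ _ trivial
      (fun _ _ _ _ => trivial) hc ?_ ?_
    · intro b _
      exact le_retain_right _ _
    · intro b hb c' _
      exact hb.trans (le_retain_left _ _)

theorem PathFinder.Approximates.pos (hF : F.Approximates γ) {n : ℕ} (loc : Fin n → X)
    (i : Fin n) : 0 < γ := by
  obtain ⟨-, h, -⟩ := hF n loc {i} i i 1 (by simp) (by simp) le_rfl (by simp)
  by_contra hγ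
  have : γ * ((F.find loc {i} i i 1).toFinset.card : ℝ) ≤ 0 :=
    mul_nonpos_of_nonpos_of_nonneg (not_lt.1 hγ) (Nat.cast_nonneg _)
  push_cast at h
  linarith

/-- The requests that a unit-speed run services, with the times of service. -/
theorem exists_visits (I : Instance X) {R : List (Fin I.n × ℝ)} (hR : IsRun I.loc 1 R) :
    ∃ (O : Finset (Fin I.n)) (t : Fin I.n → ℝ), O.card = profit I R ∧
      (∀ i ∈ O, I.opens i ≤ t i ∧ t i < I.closes i) ∧
      ∀ i ∈ O, ∀ j ∈ O, dist (I.loc i) (I.loc j) ≤ |t i - t j| := by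
  classical
  have htrans : R.Pairwise fun a b => a.2 ≤ b.2 ∧
      dist (I.loc a.1) (I.loc b.1) ≤ 1 * (b.2 - a.2) := by
    have : IsTrans (Fin I.n × ℝ) fun a b => a.2 ≤ b.2 ∧
        dist (I.loc a.1) (I.loc b.1) ≤ 1 * (b.2 - a.2) :=
      ⟨fun a b c h1 h2 => ⟨h1.1.trans h2.1,
        (dist_triangle _ (I.loc b.1) _).trans (by linarith [h1.2, h2.2])⟩⟩
    exact List.isChain_iff_pairwise.1 hR
  have hpair : ∀ a ∈ R, ∀ b ∈ R, dist (I.loc a.1) (I.loc b.1) ≤ |a.2 - b.2| := by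
    have : Std.Symm fun a b : Fin I.n × ℝ => dist (I.loc a.1) (I.loc b.1) ≤ |a.2 - b.2| :=
      ⟨fun a b h => by rw [dist_comm, abs_sub_comm]; exact h⟩
    have := List.Pairwise.forall_of_forall (l := R)
      (R := fun a b : Fin I.n × ℝ => dist (I.loc a.1) (I.loc b.1) ≤ |a.2 - b.2|) (by simp)
      (htrans.imp fun {a b} h => by
        rw [abs_sub_comm, abs_of_nonneg (sub_nonneg.2 h.1)]; linarith [h.2])
    exact fun a ha b hb => this ha hb
  set O := Finset.univ.filter fun i : Fin I.n =>
    ∃ t : ℝ, (i, t) ∈ R ∧ I.opens i ≤ t ∧ t < I.closes i with hO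
  have hex : ∀ i : Fin I.n, ∃ t : ℝ, i ∈ O → (i, t) ∈ R ∧ I.opens i ≤ t ∧ t < I.closes i := by
    intro i
    by_cases hi : i ∈ O
    · obtain ⟨t, ht⟩ := (Finset.mem_filter.1 hi).2
      exact ⟨t, fun _ => ht⟩
    · exact ⟨0, fun h => absurd h hi⟩
  choose t ht using hex
  refine ⟨O, t, ?_, fun i hi => (ht i hi).2, fun i hi j hj =>
    hpair _ (ht i hi).1 _ (ht j hj).1⟩
  rw [hO, profit]

theorem floor_closes_sub_floor_opens {σ w e : ℝ} (h1 : 3 / 2 ≤ e - w) (h2 : e - w ≤ 2) :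
    ⌊(e - σ) / (3 / 4)⌋ = ⌊(w - σ) / (3 / 4)⌋ + 2 ∨
      ⌊(e - σ) / (3 / 4)⌋ = ⌊(w - σ) / (3 / 4)⌋ + 3 := by
  have a1 := Int.floor_le ((e - σ) / (3 / 4))
  have a2 := Int.lt_floor_add_one ((e - σ) / (3 / 4))
  have b1 := Int.floor_le ((w - σ) / (3 / 4))
  have b2 := Int.lt_floor_add_one ((w - σ) / (3 / 4))
  have c1 : ((⌊(w - σ) / (3 / 4)⌋ : ℤ) : ℝ) + 1 < ((⌊(e - σ) / (3 / 4)⌋ : ℤ) : ℝ) := by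
    by_contra h
    have : ⌊(e - σ) / (3 / 4)⌋ ≤ ⌊(w - σ) / (3 / 4)⌋ + 1 := by exact_mod_cast not_lt.1 h
    have : (⌊(e - σ) / (3 / 4)⌋ : ℝ) ≤ ⌊(w - σ) / (3 / 4)⌋ + 1 := by exact_mod_cast this
    linarith
  have c2 : ((⌊(e - σ) / (3 / 4)⌋ : ℤ) : ℝ) < ((⌊(w - σ) / (3 / 4)⌋ : ℤ) : ℝ) + 4 := by linarith
  have d1 : ⌊(w - σ) / (3 / 4)⌋ + 1 < ⌊(e - σ) / (3 / 4)⌋ := by exact_mod_cast c1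
  have d2 : ⌊(e - σ) / (3 / 4)⌋ < ⌊(w - σ) / (3 / 4)⌋ + 4 := by exact_mod_cast c2
  omega

theorem trim_first {X : Type u} {I : Instance X} {σ : ℝ} {i : Fin I.n} (h1 : 3 / 2 ≤ I.closes i - I.opens i)
    (h2 : I.closes i - I.opens i ≤ 2) :
    trim I (3 / 4) σ (choice₂ 1) i = some (⌊(I.opens i - σ) / (3 / 4)⌋ + 1) := by
  rcases floor_closes_sub_floor_opens (σ := σ) h1 h2 with h | h
  · have : (fullPeriods (3 / 4) σ (I.opens i) (I.closes i)).card = 1 := by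
      rw [card_fullPeriods, h]; omega
    simp [trim_eq, this, choice₂]
  · have : (fullPeriods (3 / 4) σ (I.opens i) (I.closes i)).card = 2 := by
      rw [card_fullPeriods, h]; omega
    simp [trim_eq, this, choice₂]

theorem trim_last {X : Type u} {I : Instance X} {σ : ℝ} {i : Fin I.n} (h1 : 3 / 2 ≤ I.closes i - I.opens i)
    (h2 : I.closes i - I.opens i ≤ 2) :
    trim I (3 / 4) σ (choice₂ 2) i = some (⌊(I.closes i - σ) / (3 / 4)⌋ - 1) := by
  rcases floor_closes_sub_floor_opens (σ := σ) h1 h2 with h | h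
  · have : (fullPeriods (3 / 4) σ (I.opens i) (I.closes i)).card = 1 := by
      rw [card_fullPeriods, h]; omega
    simp only [trim_eq, this, choice₂, Option.map_some, h]
    congr 1
    push_cast
    ring
  · have : (fullPeriods (3 / 4) σ (I.opens i) (I.closes i)).card = 2 := by
      rw [card_fullPeriods, h]; omega
    simp only [trim_eq, this, choice₂, Option.map_some, h]
    congr 1
    push_cast
    ring

theorem card_mul_le_of_serviceable {v : ℝ} {q r : ℕ} (hr : 0 < r) (h1 : (17 / 7 : ℝ) ≤ (q : ℝ) / r)
    (h2 : (q : ℝ) / r ≤ 3) (hv : (q : ℝ) / r ≤ v)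
    (hlen : ∀ i, 3 / 2 ≤ I.closes i - I.opens i ∧ I.closes i - I.opens i ≤ 2) {G : ℝ}
    (hG : ∀ i < 3, ∀ j < r, ∀ b, b = 1 ∨ b = 2 → ∀ H τ, Serviceable I.loc v (3 / 4)
      (gridStart r i j) (trim I (3 / 4) (gridStart r i j) (choice₂ b)) H τ → (H.card : ℝ) ≤ G)
    {R : List (Fin I.n × ℝ)} (hR : IsRun I.loc 1 R) :
    profit I R * (1 + 3 * ((q : ℝ) / r) - ((q : ℝ) / r) ^ 2) ≤ (23 - 7 * ((q : ℝ) / r)) * G := by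
  classical
  obtain ⟨O, t, hO, hwin, hdist⟩ := exists_visits I hR
  rw [← hO]
  refine card_mul_le_of_runs O I.opens I.closes t hr h1 h2 (fun i _ => (hlen i).2)
    (fun i hi => (hwin i hi).1) (fun i hi => (hwin i hi).2.le) rfl ?_ ?_
  · intro i hi j hj θ
    refine hG i hi j hj 1 (.inl rfl) _ _ (serviceable_of_racing (s₀ := (q : ℝ) / r) _
      (-(3 / 4) + θ) (by linarith) hv (by norm_num)
      (fun a => ⌊(I.opens a - gridStart r i j) / (3 / 4)⌋ + 1) t
      (fun a _ => trim_first (hlen a).1 (hlen a).2)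
      (fun a ha b hb => hdist a (Finset.mem_filter.1 ha).1 b (Finset.mem_filter.1 hb).1) ?_)
    intro a ha
    obtain ⟨h3, h4⟩ := (Finset.mem_filter.1 ha).2
    unfold nextBoundary at h3 h4
    constructor <;> linarith
  · intro i hi j hj θ
    refine hG i hi j hj 2 (.inr rfl) _ _ (serviceable_of_racing (s₀ := (q : ℝ) / r) _
      (3 / 4 - 3 / 4 * ((q : ℝ) / r - 1) / 2 - θ) (by linarith) hv (by norm_num)
      (fun a => ⌊(I.closes a - gridStart r i j) / (3 / 4)⌋ - 1) t
      (fun a _ => trim_last (hlen a).1 (hlen a).2)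
      (fun a ha b hb => hdist a (Finset.mem_filter.1 ha).1 b (Finset.mem_filter.1 hb).1) ?_)
    intro a ha
    obtain ⟨h3, h4⟩ := (Finset.mem_filter.1 ha).2
    unfold lastBoundary at h3 h4
    push_cast
    constructor <;> linarith

theorem mem_calls {i b : ℕ} (hi : i < 3) (hb : b = 1 ∨ b = 2) :
    ((3 : ℝ) / 4, (i : ℝ) / 4, choice₂ b) ∈ calls := by
  simp only [calls, List.mem_append]
  refine .inl (.inr ?_)
  rw [List.mem_flatMap]
  exact ⟨i, by simpa using hi, List.mem_map.2 ⟨b, by simpa using hb, rfl⟩⟩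

theorem speedupW12_isApproximation (hF : F.Approximates γ) (I : Instance X) (S : Speedup)
    (hlen : ∀ i, 3 / 2 ≤ I.closes i - I.opens i ∧ I.closes i - I.opens i ≤ 2)
    (hs1 : 17 / 7 ≤ S.val) (hs2 : S.val ≤ 3) :
    IsApproximation I S.val (γ * (23 - 7 * S.val) / (1 + 3 * S.val - S.val ^ 2))
      (speedupW12 F I S).val := by
  have hv : 0 < S.val := by linarith
  obtain ⟨best, hbest, ⟨hrun, hprofit⟩, hcalls⟩ := exists_speedupW12_eq hF I hv
  rw [hbest]
  refine ⟨hrun, fun R hR => ?_⟩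
  rcases Nat.eq_zero_or_pos I.n with h0 | hn
  · have hz : ∀ R : List (Fin I.n × ℝ), profit I R = 0 := fun R =>
      Nat.eq_zero_of_le_zero ((Finset.card_le_univ _).trans_eq (by rw [Fintype.card_fin, h0]))
    simp [hz]
  have hγ := (hF.pos I.loc ⟨0, hn⟩).le
  have hden : 0 < 1 + 3 * S.val - S.val ^ 2 := by nlinarith
  suffices key : profit I R * (1 + 3 * S.val - S.val ^ 2) ≤
      (23 - 7 * S.val) * (γ * best.1) by
    rw [div_mul_eq_mul_div, le_div_iff₀ hden]
    refine key.trans ?_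
    have h1 : γ * (best.1 : ℝ) ≤ γ * profit I best.2 := by gcongr
    have h2 : 0 ≤ 23 - 7 * S.val := by linarith
    calc _ ≤ (23 - 7 * S.val) * (γ * profit I best.2) := by gcongr
      _ = _ := by ring
  have hG : ∀ (σ : ℝ) (i : ℕ), i < 3 → (∀ r, S.hops = some r →
      ∃ j < r, σ = (i : ℝ) / 4 + (j : ℝ) / r * (3 / 4)) → ∀ b, b = 1 ∨ b = 2 → ∀ H τ,
      Serviceable I.loc S.val (3 / 4) σ (trim I (3 / 4) σ (choice₂ b)) H τ →
      (H.card : ℝ) ≤ γ * best.1 := by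
    intro σ i hi hσ b hb H τ hH
    refine (speedup_complete_hops hF hγ hv (by norm_num) hσ hH).trans ?_
    have := hcalls _ (mem_calls hi hb)
    gcongr
  cases S with
  | frac q r =>
    have hr : 0 < r := by
      rcases Nat.eq_zero_or_pos r with rfl | h
      · simp [Speedup.val] at hv
      · exact h
    obtain ⟨q', r', hr', hops, hval⟩ : ∃ q' r' : ℕ, 0 < r' ∧
        (Speedup.frac q r).hops = some r' ∧ (Speedup.frac q r).val = (q' : ℝ) / r' := by
      by_cases he : Even (q + r)
      · exact ⟨q, r, hr, by simp [Speedup.hops, he], rfl⟩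
      · refine ⟨2 * q, 2 * r, by omega, by simp [Speedup.hops, he], ?_⟩
        push_cast
        rw [mul_div_mul_left _ _ two_ne_zero]
        rfl
    rw [hval] at hs1 hs2 ⊢
    refine card_mul_le_of_serviceable hr' hs1 hs2 hval.ge hlen (fun i hi j hj b hb H τ hH => ?_) hR
    refine hG _ i hi (fun r hr => ⟨j, ?_, ?_⟩) b hb H τ hH
    · rw [hops, Option.some.injEq] at hr; omega
    · rw [hops, Option.some.injEq] at hr; rw [← hr]; rfl
  | real s =>
    have hrat : ∀ q r : ℕ, 0 < r → (17 / 7 : ℝ) ≤ (q : ℝ) / r → (q : ℝ) / r ≤ s →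
        profit I R * (1 + 3 * ((q : ℝ) / r) - ((q : ℝ) / r) ^ 2) ≤
          (23 - 7 * ((q : ℝ) / r)) * (γ * best.1) := fun q r hr h1 h2 =>
      card_mul_le_of_serviceable hr h1 (h2.trans hs2) h2 hlen
        (fun i hi j hj b hb H τ hH => hG _ i hi (fun r hr => by simp [Speedup.hops] at hr)
          b hb H τ hH) hR
    change (17 / 7 : ℝ) ≤ s at hs1
    change profit I R * (1 + 3 * s - s ^ 2) ≤ (23 - 7 * s) * (γ * best.1)
    rcases hs1.eq_or_lt with h | h
    · have := hrat 17 7 (by norm_num) (by norm_num) (by push_cast; exact h.le)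
      push_cast at this
      rwa [h] at this
    · by_contra hcon
      have hopen : IsOpen {x : ℝ | (23 - 7 * x) * (γ * best.1) <
          profit I R * (1 + 3 * x - x ^ 2)} := isOpen_lt (by fun_prop) (by fun_prop)
      obtain ⟨ε, hε, hball⟩ := Metric.isOpen_iff.1 hopen s (not_le.1 hcon)
      obtain ⟨x, hx1, hx2⟩ := exists_rat_btwn (show max (17 / 7) (s - ε) < s from
        max_lt h (by linarith))
      have hx3 := (le_max_left _ _).trans_lt hx1
      have hx4 := (le_max_right _ _).trans_lt hx1
      have hmem := hball (show (x : ℝ) ∈ Metric.ball s ε by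
        rw [Metric.mem_ball, Real.dist_eq, abs_lt]; constructor <;> linarith)
      have hxq : (x : ℝ) = ((x.num.toNat : ℕ) : ℝ) / (x.den : ℕ) := by
        have h0 : 0 ≤ x.num := Rat.num_nonneg.2 (by
          have : (0 : ℝ) < x := by linarith
          exact_mod_cast this.le)
        have h1 : ((x.num.toNat : ℕ) : ℝ) = (x.num : ℝ) := by
          exact_mod_cast Int.toNat_of_nonneg h0
        rw [h1]
        exact_mod_cast (Rat.num_div_den x).symm
      rw [Set.mem_ofPred_eq, hxq] at hmem
      rw [hxq] at hx2 hx3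
      exact absurd (hrat _ _ x.den_pos hx3.le hx2.le) (not_le.2 hmem)

end Runs

/-! ### Running time -/

section Counting

variable {X : Type u} (I : Instance X)

/-- The relative positions at which windows start or end within periods of length `1/2`. -/
noncomputable def halfBreaks : Finset ℝ :=
  Finset.univ.image (fun i => Int.fract (2 * I.opens i)) ∪
    Finset.univ.image fun i => Int.fract (2 * I.closes i)

theorem finite_periodSets :
    ((fun (σ : ℝ) (i : Fin I.n) => fullPeriods (1 / 2) σ (I.opens i) (I.closes i)) ''
      Set.Ico 0 (1 / 2)).Finite := by
  have hfl : ∀ x σ : ℝ, σ ∈ Set.Ico (0 : ℝ) (1 / 2) →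
      ⌊(x - σ) / (1 / 2)⌋ ∈ Finset.Icc (⌊2 * x⌋ - 1) ⌊2 * x⌋ := by
    intro x σ hσ
    rw [Finset.mem_Icc, Int.le_floor]
    constructor
    · push_cast
      linarith [Int.floor_le (2 * x), hσ.2]
    · exact Int.floor_le_floor (by linarith [hσ.1])
  refine Set.Finite.subset (Set.Finite.pi' (t := fun i : Fin I.n =>
    (((Finset.Icc (⌊2 * I.opens i⌋ - 1) ⌊2 * I.opens i⌋ ×ˢ
      Finset.Icc (⌊2 * I.closes i⌋ - 1) ⌊2 * I.closes i⌋).image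
        fun p : ℤ × ℤ => Finset.Ico (p.1 + 1) p.2 : Finset (Finset ℤ)) : Set (Finset ℤ)))
    fun i => Finset.finite_toSet _) ?_
  rintro _ ⟨σ, hσ, rfl⟩ i
  rw [Finset.mem_coe, Finset.mem_image]
  exact ⟨(⌊(I.opens i - σ) / (1 / 2)⌋, ⌊(I.closes i - σ) / (1 / 2)⌋),
    Finset.mem_product.2 ⟨hfl _ _ hσ, hfl _ _ hσ⟩, rfl⟩

theorem numPeriodSets_pos : 0 < numPeriodSets I :=
  (Set.ncard_pos (finite_periodSets I)).2
    ((Set.nonempty_Ico.2 (by norm_num)).image _)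

theorem floor_ne_of_fract_lt {x p : ℝ} (hp : Int.fract (2 * x) < p) (h1 : p < 1) :
    ⌊(x - Int.fract (2 * x) / 2) / (1 / 2)⌋ ≠ ⌊(x - p / 2) / (1 / 2)⌋ := by
  have h0 := Int.fract_nonneg (2 * x)
  have h2 : Int.fract (2 * x) = 2 * x - ⌊2 * x⌋ := rfl
  have e1 : ⌊(x - Int.fract (2 * x) / 2) / (1 / 2)⌋ = ⌊2 * x⌋ := by
    rw [Int.floor_eq_iff]; constructor <;> linarith
  have e2 : ⌊(x - p / 2) / (1 / 2)⌋ = ⌊2 * x⌋ - 1 := by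
    rw [Int.floor_eq_iff]; push_cast; constructor <;> linarith
  omega

theorem card_halfBreaks_le (hlen : ∀ i, 3 / 2 ≤ I.closes i - I.opens i) :
    (halfBreaks I).card ≤ numPeriodSets I := by
  rw [← Set.ncard_coe_finset, numPeriodSets]
  have hlt : ∀ p ∈ halfBreaks I, 0 ≤ p ∧ p < 1 := by
    intro p hp
    rcases Finset.mem_union.1 hp with h | h <;> obtain ⟨i, -, rfl⟩ := Finset.mem_image.1 h <;>
      exact ⟨Int.fract_nonneg _, Int.fract_lt_one _⟩
  have hinj : ∀ p ∈ halfBreaks I, ∀ p' ∈ halfBreaks I, p < p' →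
      (fun i : Fin I.n => fullPeriods (1 / 2) (p / 2) (I.opens i) (I.closes i)) ≠
        fun i => fullPeriods (1 / 2) (p' / 2) (I.opens i) (I.closes i) := by
    intro p hp p' hp' hpp heq
    have hfloor : ∀ σ i, ⌊(I.opens i - σ) / (1 / 2)⌋ + 1 < ⌊(I.closes i - σ) / (1 / 2)⌋ := by
      intro σ i
      have h1 := Int.floor_le ((I.opens i - σ) / (1 / 2))
      rw [← Int.add_one_le_iff, Int.le_floor]
      push_cast
      linarith [hlen i]
    have key : ∀ i, ⌊(I.opens i - p / 2) / (1 / 2)⌋ = ⌊(I.opens i - p' / 2) / (1 / 2)⌋ ∧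
        ⌊(I.closes i - p / 2) / (1 / 2)⌋ = ⌊(I.closes i - p' / 2) / (1 / 2)⌋ := by
      intro i
      have hi := congrArg (fun s : Finset ℤ => (s : Set ℤ)) (congrFun heq i)
      simp only [fullPeriods, Finset.coe_Ico] at hi
      have := (Set.Ico_eq_Ico_iff (.inl (hfloor (p / 2) i))).1 hi
      exact ⟨by omega, this.2⟩
    rcases Finset.mem_union.1 hp with h | h <;> obtain ⟨i, -, rfl⟩ := Finset.mem_image.1 h
    · exact floor_ne_of_fract_lt hpp (hlt _ hp').2 (key i).1
    · exact floor_ne_of_fract_lt hpp (hlt _ hp').2 (key i).2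
  refine Set.ncard_le_ncard_of_injOn (fun p : ℝ => fun i : Fin I.n =>
    fullPeriods (1 / 2) (p / 2) (I.opens i) (I.closes i)) ?_ ?_ (finite_periodSets I)
  · intro p hp
    obtain ⟨h1, h2⟩ := hlt p hp
    exact ⟨p / 2, ⟨by linarith, by linarith⟩, rfl⟩
  · intro p hp p' hp' heq
    rcases lt_trichotomy p p' with h | h | h
    · exact absurd heq (hinj p hp p' hp' h)
    · exact h
    · exact absurd heq.symm (hinj p' hp' p hp h)

theorem length_le_of_subset_shiftList (hlen : ∀ i, 3 / 2 ≤ I.closes i - I.opens i) {α : ℝ}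
    (hα : 0 < α) (N : ℤ) (hN : N * α = 3) (base : ℝ) {l : List ℝ} (hl : l.Nodup)
    (hsub : ∀ y ∈ l, y ∈ shiftList I α base) : l.length ≤ 6 * numPeriodSets I := by
  have hx : ∀ x : ℝ, Int.fract (2 * x) ∈ halfBreaks I → Int.fract ((x - base) / α) ∈
      ((halfBreaks I) ×ˢ (Finset.Ico (0 : ℤ) 6)).image
        fun p : ℝ × ℤ => Int.fract ((((p.2 : ℝ) + p.1) / 2 - base) / α) := by
    intro x hx
    refine Finset.mem_image.2 ⟨(Int.fract (2 * x), ⌊2 * x⌋ % 6), Finset.mem_product.2 ⟨hx,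
      Finset.mem_Ico.2 ⟨Int.emod_nonneg _ (by norm_num), Int.emod_lt_of_pos _ (by norm_num)⟩⟩, ?_⟩
    have h1 : (⌊2 * x⌋ : ℝ) = 6 * (⌊2 * x⌋ / 6 : ℤ) + (⌊2 * x⌋ % 6 : ℤ) := by
      exact_mod_cast (Int.mul_ediv_add_emod ⌊2 * x⌋ 6).symm
    have h2 : Int.fract (2 * x) = 2 * x - ⌊2 * x⌋ := rfl
    rw [Int.fract_eq_fract]
    refine ⟨-(N * (⌊2 * x⌋ / 6)), ?_⟩
    rw [h2, h1]
    push_cast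
    field_simp
    linear_combination (2 * ((⌊2 * x⌋ / 6 : ℤ) : ℝ)) * hN
  have hs : l.toFinset ⊆ ((halfBreaks I) ×ˢ (Finset.Ico (0 : ℤ) 6)).image
      fun p : ℝ × ℤ => Int.fract ((((p.2 : ℝ) + p.1) / 2 - base) / α) := by
    intro y hy
    obtain ⟨i, rfl | rfl⟩ := mem_shiftList.1 (hsub y (List.mem_toFinset.1 hy))
    · exact hx _ (Finset.mem_union_left _ (Finset.mem_image_of_mem _ (Finset.mem_univ i)))
    · exact hx _ (Finset.mem_union_right _ (Finset.mem_image_of_mem _ (Finset.mem_univ i)))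
  rw [← List.toFinset_card_of_nodup hl]
  calc l.toFinset.card ≤ _ := Finset.card_le_card hs
    _ ≤ _ := Finset.card_image_le
    _ = 6 * (halfBreaks I).card := by simp [mul_comm]
    _ ≤ 6 * numPeriodSets I := Nat.mul_le_mul_left _ (card_halfBreaks_le I hlen)

end Counting

section Cost

variable {X : Type u} [MetricSpace X] {F : PathFinder X} {Γ : ℕ → ℕ} {I : Instance X} {S : Speedup}

theorem PathFinder.RunsWithin.sq_le (hΓ : F.RunsWithin Γ) {n : ℕ} (loc : Fin n → X) :
    (n + 1) ^ 2 ≤ Γ n := by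
  refine le_trans ?_ (hΓ n loc 1 1 0 (fun _ => none) one_pos one_pos)
  unfold repairman
  rw [Timed.cost_bind, Timed.cost_tick]
  exact Nat.le_add_right _ _

theorem cost_speedup_le (hΓ : F.RunsWithin Γ) (hv : 0 < S.val) {α : ℝ} (hα : 0 < α) (base : ℝ)
    (choice : ℕ → Option ℕ) {K : ℕ}
    (hK : (∀ l' : List ℝ, l'.Nodup → (∀ x ∈ l', x ∈ shiftList I α base) → l'.length ≤ K) ∨
      S.hops = some K) :
    (speedup F I S α base choice).cost ≤ (4 * K + 3) * Γ I.n := by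
  obtain ⟨hlen, hcost⟩ := periodStarts_bounds hK
  have hsq := hΓ.sq_le I.loc
  have h1 : I.n + 1 ≤ Γ I.n := by nlinarith
  have h2 : 2 * I.n ≤ Γ I.n := by nlinarith
  have hfold := Timed.cost_foldlM_le (periodStarts I S α base).val
    (fun (best : ℕ × List (Fin I.n × ℝ)) σ => do
      tick (I.n + 1)
      let new ← repairman F I.loc S.val α σ (trim I α σ choice)
      pure (retain best new)) (0, []) (Γ I.n + Γ I.n) (fun b σ _ => by
        simp only [Timed.cost_bind, Timed.cost_tick, Timed.cost_pure, add_zero]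
        exact add_le_add h1 (hΓ _ _ _ _ _ _ hv hα))
  unfold speedup
  rw [Timed.cost_bind]
  have h3 : 2 * I.n * (K + 1) ≤ Γ I.n * (K + 1) := Nat.mul_le_mul_right _ h2
  have h4 : K + 1 ≤ Γ I.n * (K + 1) := Nat.le_mul_of_pos_left _ (by omega)
  have h5 := Nat.mul_le_mul_right (Γ I.n + Γ I.n) hlen
  refine (add_le_add hcost (hfold.trans h5)).trans ?_
  calc I.n + 1 + (2 * I.n * (K + 1) + (K + 1)) + K * (Γ I.n + Γ I.n)
      ≤ Γ I.n + (Γ I.n * (K + 1) + Γ I.n * (K + 1)) + K * (Γ I.n + Γ I.n) := by gcongr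
    _ = (4 * K + 3) * Γ I.n := by ring

theorem calls_period {c : ℝ × ℝ × (ℕ → Option ℕ)} (hc : c ∈ calls) :
    0 < c.1 ∧ ∃ N : ℤ, N * c.1 = 3 := by
  simp only [calls, List.mem_append, List.mem_flatMap, List.mem_map] at hc
  rcases hc with (⟨i, -, j, -, k, -, rfl⟩ | ⟨i, -, j, -, rfl⟩) | ⟨i, -, rfl⟩
  · exact ⟨by norm_num, 6, by norm_num⟩
  · exact ⟨by norm_num, 4, by norm_num⟩
  · exact ⟨by norm_num, 3, by norm_num⟩

theorem length_calls : calls.length = 22 := by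
  simp [calls, List.range_succ]

theorem cost_speedupW12_le (hΓ : F.RunsWithin Γ) (hv : 0 < S.val) {K : ℕ} (hK0 : 0 < K)
    (hK : (∀ α base : ℝ, 0 < α → (∃ N : ℤ, N * α = 3) → ∀ l' : List ℝ, l'.Nodup →
      (∀ x ∈ l', x ∈ shiftList I α base) → l'.length ≤ K) ∨ S.hops = some K) :
    (speedupW12 F I S).cost ≤ 176 * (K * Γ I.n) := by
  have hsq := hΓ.sq_le I.loc
  have h1 : 1 ≤ Γ I.n := (Nat.one_le_pow _ _ (Nat.succ_pos _)).trans hsq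
  have h2 : 1 ≤ K * Γ I.n := Nat.mul_pos hK0 h1
  have hfold := Timed.cost_foldlM_le calls
    (fun (best : ℕ × List (Fin I.n × ℝ)) c => do
      let new ← speedup F I S c.1 c.2.1 c.2.2
      tick 1
      pure (retain best new)) (0, []) ((4 * K + 3) * Γ I.n + 1) (fun b c hc => by
        obtain ⟨hα, hN⟩ := calls_period hc
        simp only [Timed.cost_bind, Timed.cost_tick, Timed.cost_pure, add_zero]
        exact Nat.add_le_add_right (cost_speedup_le hΓ hv hα _ _
          (hK.imp_left fun h => h c.1 c.2.1 hα hN)) _)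
  rw [length_calls] at hfold
  have h3 : Γ I.n ≤ K * Γ I.n := Nat.le_mul_of_pos_left _ hK0
  unfold speedupW12
  rw [Timed.cost_bind, Timed.cost_pure, add_zero]
  refine hfold.trans ?_
  rw [add_mul, mul_assoc]
  omega

end Cost

end Repairman

theorem mainTheorem9 :
    ∃ C : ℕ, ∀ (X : Type u) [MetricSpace X] (F : Repairman.PathFinder X) (γ : ℝ) (Γ : ℕ → ℕ),
      F.Approximates γ → F.RunsWithin Γ →
      ∀ (I : Repairman.Instance X) (β : ℝ) (S : Repairman.Speedup),
        (∀ i, 1 ≤ I.closes i - I.opens i ∧ I.closes i - I.opens i ≤ 2) →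
        (∀ i, Repairman.InW 3 (1 / 2) β (I.opens i) (I.closes i)) →
        17 / 7 ≤ S.val → S.val ≤ 3 →
        Repairman.IsApproximation I S.val
          (γ * (23 - 7 * S.val) / (1 + 3 * S.val - S.val ^ 2))
          (Repairman.speedupW12 F I S).val ∧
        (Repairman.speedupW12 F I S).cost ≤ C * (Repairman.numPeriodSets I * Γ I.n) ∧
        ∀ q r : ℕ, S = .frac q r →
          (Repairman.speedupW12 F I S).cost ≤
            C * (min r (Repairman.numPeriodSets I) * Γ I.n) := by
  refine ⟨1056, fun X _ F γ Γ hF hΓ I β S hwin hW hs1 hs2 => ?_⟩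
  have hv : 0 < S.val := by linarith
  have hlen : ∀ i, 3 / 2 ≤ I.closes i - I.opens i := by
    intro i
    have h := hW i
    rw [Repairman.InW, Repairman.card_fullPeriods] at h
    have h1 : ⌊(I.opens i - β) / (1 / 2)⌋ + 4 = ⌊(I.closes i - β) / (1 / 2)⌋ := by omega
    have h2 := Int.lt_floor_add_one ((I.opens i - β) / (1 / 2))
    have h3 := Int.floor_le ((I.closes i - β) / (1 / 2))
    rw [← h1] at h3
    push_cast at h3
    linarith
  have hm := Repairman.numPeriodSets_pos I
  have hcost : (Repairman.speedupW12 F I S).cost ≤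
      1056 * (Repairman.numPeriodSets I * Γ I.n) := by
    refine (Repairman.cost_speedupW12_le hΓ hv (K := 6 * Repairman.numPeriodSets I) (by omega)
      (.inl ?_)).trans_eq (by ring)
    rintro α base hα ⟨N, hN⟩ l hl hsub
    exact Repairman.length_le_of_subset_shiftList I hlen hα N hN base hl hsub
  refine ⟨Repairman.speedupW12_isApproximation hF I S (fun i => ⟨hlen i, (hwin i).2⟩) hs1 hs2,
    hcost, ?_⟩
  rintro q r rfl
  rcases le_total (Repairman.numPeriodSets I) r with h | h
  · simpa only [min_eq_right h] using hcost
  · simp only [min_eq_left h]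
    have hr : 0 < r := by
      rcases Nat.eq_zero_or_pos r with rfl | hr
      · simp [Repairman.Speedup.val] at hv
      · exact hr
    obtain ⟨K, hK, hK0, hle⟩ : ∃ K, (Repairman.Speedup.frac q r).hops = some K ∧ 0 < K ∧
        K ≤ 2 * r := by
      refine ⟨if Even (q + r) then r else 2 * r, rfl, ?_, ?_⟩ <;> split_ifs <;> omega
    refine (Repairman.cost_speedupW12_le hΓ hv hK0 (.inr hK)).trans ?_
    have h1 : K * Γ I.n ≤ 2 * (r * Γ I.n) := by
      rw [← mul_assoc]; exact Nat.mul_le_mul_right _ hle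
    have h2 := Nat.zero_le (r * Γ I.n)
    generalize K * Γ I.n = a at h1 ⊢
    generalize r * Γ I.n = b at h1 h2 ⊢
    omega
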